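/- Let $\Gamma$ be a finite set with $N=\operatorname{card}\Gamma>1$ elements and let $J,Q\ge 1$ be integers. Let $G_\bigcirc(J,Q)$ be the directed graph consisting of $J$ directed circles of $Q$ edges each, which have exactly one vertex $v_\bigcirc$ in common and are otherwise disjoint. Let $G_\bigcirc(N,J,Q)$ be the graph obtained from it by attaching to $v_\bigcirc$, for every $\gamma\in\Gamma$, two loops $e(\gamma(-))$ and $e(\gamma(+))$; every edge is labeled by itself. Let $\mathcal D_N$ be the Dyck inverse monoid (polycyclic monoid), that is, the monoid with zero generated by $\gamma(-),\gamma(+)$ $(\gamma\in\Gamma)$ with the relations $\gamma(-)\gamma(+)=\mathbf 1$ and $\gamma(-)\gamma'(+)=0$ for $\gamma\ne\gamma'$. Let $\varphi$ send the edges of the circles to $\mathbf 1$, and $e(\gamma(\pm))$ to $\gamma(\pm)$. Let $X(G_\bigcirc(N,J,Q))$ be the subshift, with the edges as alphabet, whose admissible words are the finite paths $(e_i)_{1\le i\le I}$ in $G_\bigcirc(N,J,Q)$ such that $\prod_{1\le i\le I}\varphi(e_i)\neq 0$ in $\mathcal D_N$. For a shift invariant set $Y$ of bi-infinite sequences let $P_n(Y)$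 be the set of points of $Y$ that are fixed by the $n$-th power of the shift, and let $\zeta_Y(z)=\exp\big(\sum_{n\ge1}\frac1n\operatorname{card}(P_n(Y))z^n\big)$ be its zeta function. Then $$ \zeta_{X(G_\bigcirc(N,J,Q))}(z)=\frac{2\left(1-Jz^Q+\sqrt{(1-Jz^Q)^2-4Nz^2}\right)}{\left(1-Jz^Q-2Nz+\sqrt{(1-Jz^Q)^2-4Nz^2}\right)^2}, $$ as an identity of formal power series in $z$ with rational coefficients, where the square root is the one with constant term $1$, and as an identity of functions for all complex $z$ in some neighbourhood of $0$, on which the series in the exponent converges absolutely and the denominator does not vanish, where the square root is the principal one. -/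

import Mathlib

open scoped PowerSeries

/-! ### Labeled directed graphs and paths -/

/-- A directed graph (multiple edges and loops allowed) with vertex set `V` and edge set `E`,
whose edges carry labels in `A`. -/
structure LabeledGraph (V E A : Type*) where
  src : E → V
  tgt : E → V
  label : E → A

namespace LabeledGraph

/-- A finite sequence of edges is a path if every edge starts where the previous one ends. -/
def IsPath {V E A : Type*} (G : LabeledGraph V E A) (p : List E) : Prop :=
  p.IsChain fun e e' => G.tgt e = G.src e'

end LabeledGraph

/-! ### The Dyck inverse monoid and the admissible words of the Motzkin shift -/

/-- The generators `γ(-)`, `γ(+)` of the Dyck inverse monoid, together with its zero. -/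
inductive DyckGen (Γ : Type*)
  | neg (γ : Γ)
  | pos (γ : Γ)
  | zero

/-- The defining relations of the Dyck inverse monoid (as a monoid with zero). -/
inductive DyckRel (Γ : Type*) : FreeMonoid (DyckGen Γ) → FreeMonoid (DyckGen Γ) → Prop
  | neg_mul_pos (γ : Γ) :
      DyckRel Γ (FreeMonoid.of (DyckGen.neg γ) * FreeMonoid.of (DyckGen.pos γ)) 1
  | neg_mul_pos_of_ne (γ γ' : Γ) (h : γ ≠ γ') :
      DyckRel Γ (FreeMonoid.of (DyckGen.neg γ) * FreeMonoid.of (DyckGen.pos γ'))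
        (FreeMonoid.of DyckGen.zero)
  | zero_mul (g : DyckGen Γ) :
      DyckRel Γ (FreeMonoid.of DyckGen.zero * FreeMonoid.of g) (FreeMonoid.of DyckGen.zero)
  | mul_zero (g : DyckGen Γ) :
      DyckRel Γ (FreeMonoid.of g * FreeMonoid.of DyckGen.zero) (FreeMonoid.of DyckGen.zero)

/-- The Dyck inverse monoid (polycyclic inverse monoid) over the set `Γ`. -/
abbrev DyckMonoid (Γ : Type*) := PresentedMonoid (DyckRel Γ)

namespace DyckMonoid

/-- The zero element of the Dyck inverse monoid. -/
def zero (Γ : Type*) : DyckMonoid Γ := PresentedMonoid.of (DyckRel Γ) DyckGen.zero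

end DyckMonoid

/-- The alphabet `{γ(-), γ(+) : γ ∈ Γ} ∪ {𝟏}` of the Motzkin shift. -/
inductive MotzkinSymbol (Γ : Type*)
  | neg (γ : Γ)
  | pos (γ : Γ)
  | one

namespace MotzkinSymbol

/-- The element of the Dyck inverse monoid denoted by a symbol. -/
def val {Γ : Type*} : MotzkinSymbol Γ → DyckMonoid Γ
  | neg γ => PresentedMonoid.of (DyckRel Γ) (DyckGen.neg γ)
  | pos γ => PresentedMonoid.of (DyckRel Γ) (DyckGen.pos γ)
  | one => 1

end MotzkinSymbol

/-- A word is admissible for the Motzkin shift if its product in the Dyck inverse monoid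
is not zero. -/
def IsMotzkinAdmissible {Γ : Type*} (w : List (MotzkinSymbol Γ)) : Prop :=
  (w.map MotzkinSymbol.val).prod ≠ DyckMonoid.zero Γ

/-! ### Attaching Dyck loops to a vertex of a labeled graph -/

/-- The attached loops `e(γ(-), k)`, `1 ≤ k ≤ Kneg γ`, and `e(γ(+), k)`, `1 ≤ k ≤ Kpos γ`. -/
inductive DyckLoop {Γ : Type*} (Kneg Kpos : Γ → ℕ)
  | neg (γ : Γ) (k : Fin (Kneg γ))
  | pos (γ : Γ) (k : Fin (Kpos γ))

namespace LabeledGraph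

/-- The labeled graph obtained from `G` by attaching the loops `e(γ(±), k)` to the vertex `v`;
the loops are labeled by themselves. -/
def attachLoops {V E A Γ : Type*} (G : LabeledGraph V E A) (v : V) (Kneg Kpos : Γ → ℕ) :
    LabeledGraph V (E ⊕ DyckLoop Kneg Kpos) (A ⊕ DyckLoop Kneg Kpos) where
  src := Sum.elim G.src fun _ => v
  tgt := Sum.elim G.tgt fun _ => v
  label := Sum.map G.label id

end LabeledGraph

/-- The map `φ`: labels of the original graph go to `𝟏`, the label `e(γ(±), k)` goes to `γ(±)`. -/
def loopSymbol {A Γ : Type*} {Kneg Kpos : Γ → ℕ} :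
    A ⊕ DyckLoop Kneg Kpos → MotzkinSymbol Γ
  | Sum.inl _ => MotzkinSymbol.one
  | Sum.inr (DyckLoop.neg γ _) => MotzkinSymbol.neg γ
  | Sum.inr (DyckLoop.pos γ _) => MotzkinSymbol.pos γ

namespace LabeledGraph

/-- A path in the graph with attached loops is admissible if the image under `φ` of its label
sequence is an admissible word of the Motzkin shift. -/
def IsAdmissiblePath {V E A Γ : Type*} {Kneg Kpos : Γ → ℕ}
    (G : LabeledGraph V (E ⊕ DyckLoop Kneg Kpos) (A ⊕ DyckLoop Kneg Kpos))
    (p : List (E ⊕ DyckLoop Kneg Kpos)) : Prop :=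
  G.IsPath p ∧ IsMotzkinAdmissible (p.map fun e => loopSymbol (G.label e))

end LabeledGraph

/-! ### Subshifts and zeta functions -/

/-- The subshift of all bi-infinite sequences all of whose finite subwords belong to `L`. -/
def subshiftOf {A : Type*} (L : Set (List A)) : Set (ℤ → A) :=
  {x | ∀ (i : ℤ) (n : ℕ), (List.ofFn fun k : Fin n => x (i + (k : ℕ))) ∈ L}

/-- The shift `(x_i) ↦ (x_{i+1})`. -/
def shiftMap {A : Type*} (x : ℤ → A) : ℤ → A := fun i => x (i + 1)

/-- `P_n(Y)`: the points of `Y` that have period `n` (not necessarily as the least period). -/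
def periodicPoints {A : Type*} (Y : Set (ℤ → A)) (n : ℕ) : Set (ℤ → A) :=
  {x ∈ Y | Function.IsPeriodicPt shiftMap n x}

/-- The `n`-th coefficient `card P_n(Y) / n` of the exponent of the zeta function, for `n ≥ 1`;
there is no term for `n = 0`. -/
noncomputable def zetaCoeff {A : Type*} (Y : Set (ℤ → A)) (n : ℕ) : ℚ :=
  if n = 0 then 0 else ((periodicPoints Y n).ncard : ℚ) / (n : ℚ)

/-- The zeta function `exp (∑_{n ≥ 1} card P_n(Y) zⁿ / n)` as a formal power series. -/
noncomputable def zetaSeries {A : Type*} (Y : Set (ℤ → A)) : ℚ⟦X⟧ :=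
  (PowerSeries.exp ℚ).subst (PowerSeries.mk (zetaCoeff Y))

/-- The exponent has no constant term, so that the substitution into `exp` is meaningful. -/
theorem hasSubst_zetaCoeff {A : Type*} (Y : Set (ℤ → A)) :
    PowerSeries.HasSubst (PowerSeries.mk (zetaCoeff Y)) := by
  apply PowerSeries.HasSubst.of_constantCoeff_zero'
  simp [← PowerSeries.coeff_zero_eq_constantCoeff_apply, zetaCoeff]

/-! ### The subshift of a graph with attached loops, and the bouquet of circles -/

/-- The subshift whose admissible words are the label sequences of the admissible paths in the
graph obtained from `G` by attaching Dyck loops to the vertex `v`. -/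
def dyckLoopShift {V E A Γ : Type*} (G : LabeledGraph V E A) (v : V) (Kneg Kpos : Γ → ℕ) :
    Set (ℤ → A ⊕ DyckLoop Kneg Kpos) :=
  subshiftOf {w | ∃ p, (G.attachLoops v Kneg Kpos).IsAdmissiblePath p ∧
    w = p.map (G.attachLoops v Kneg Kpos).label}

/-- The vertices of the bouquet of `J` circles with `Q` edges each: the base vertex, and the
vertices `v_{j,q}` with `1 ≤ q < Q`. -/
inductive BouquetVertex (J Q : ℕ)
  | base
  | inner (j : Fin J) (q : ℕ) (h : 1 ≤ q ∧ q < Q)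

/-- The point number `q` on the circle `j`; the points number `0` and `Q` are the base vertex. -/
def bouquetPoint {J Q : ℕ} (j : Fin J) (q : ℕ) : BouquetVertex J Q :=
  if h : 1 ≤ q ∧ q < Q then BouquetVertex.inner j q h else BouquetVertex.base

/-- The bouquet of `J` circles with `Q` edges each, edges labeled by themselves. The edge `(j, q)`,
`0 ≤ q < Q`, leads from the point number `q` to the point number `q + 1` on the circle `j`. -/
def bouquet (J Q : ℕ) : LabeledGraph (BouquetVertex J Q) (Fin J × Fin Q) (Fin J × Fin Q) where
  src e := bouquetPoint e.1 e.2
  tgt e := bouquetPoint e.1 (e.2 + 1)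
  label := id

/-- The subshift of the bouquet of `J` circles of length `Q` with one loop `γ(-)` and one loop
`γ(+)` attached to the base vertex for every `γ ∈ Γ`. -/
def bouquetShift (Γ : Type*) (J Q : ℕ) :
    Set (ℤ → (Fin J × Fin Q) ⊕ DyckLoop (fun _ : Γ => 1) (fun _ : Γ => 1)) :=
  dyckLoopShift (bouquet J Q) BouquetVertex.base (fun _ => 1) (fun _ => 1)

/-! A point of period `n` is a periodic path, and it is admissible exactly when no power of the
value of its period word is zero. Such a path cannot stay inside a circle, so it visits the base
vertex. If it does so `k` times per period, weighting each visit by `1/k` shows that `card P_n / n`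
is the sum over `k` of `1/k` times the number of closed walks of length `n` at the base with `k`
first returns (`card_eq_mul_sum_inv_countP`, `ncard_periodicPoints_eq`). These walks are words of
`k` letters, namely brackets of length 1 and circles of length `Q`.

Forget the colours of the brackets. A shape with `a` opening and `b` closing brackets has `N ^ max a
b` admissible colourings: cyclic cancellation of adjacent pairs forces the colours to match within
each pair and leaves the other brackets free (`ncard_cyclicColorings`). The maximum is linearised by
giving the shape the weight `N ^ b * T ^ (a - b)` and applying the functional `T ^ i ↦ N ^ max i 0`.
Hence the logarithm of the zeta function is this functional applied coefficientwise to `-log (1 -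
F)`, where `F = T X + N T⁻¹ X + J X ^ Q` (`zetaCoeff_bouquetShift`).

The functional is not multiplicative, but it is so on polynomials in `T` (evaluation at `N`) and on
polynomials in `T⁻¹` (evaluation at 1). If `D = 1 + J X ^ Q D + N X² D²` is the Dyck series, then
`(1 - F) D = (1 - T X D) (1 - N T⁻¹ X D)`, a Wiener–Hopf factorisation. Both factors evaluate to `1
- N X D`, so the zeta function is `D / (1 - N X D)²`; solving the quadratic equation for `D` gives
the closed form.

The analytic statement follows because the coefficients grow at most geometrically, and because the
principal root and the formal root have the same square and the same constant term. -/

/-! ### The series `-log (1 - X)` and its substitutions -/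

section NegLog

open PowerSeries

/-- The power series `-log (1 - X) = ∑_{n ≥ 1} Xⁿ / n`. -/
noncomputable def negLogOneSub (R : Type*) [CommRing R] [Algebra ℚ R] : R⟦X⟧ :=
  mk fun n => algebraMap ℚ R (1 / n)

theorem map_negLogOneSub {R S : Type*} [CommRing R] [Algebra ℚ R] [CommRing S] [Algebra ℚ S]
    (f : R →+* S) : PowerSeries.map f (negLogOneSub R) = negLogOneSub S := by
  ext n
  simp only [negLogOneSub, coeff_map, coeff_mk]
  rw [← Subsingleton.elim (f.comp (algebraMap ℚ R)) (algebraMap ℚ S), RingHom.comp_apply]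

theorem one_sub_X_mul_derivative_negLogOneSub (R : Type*) [CommRing R] [Algebra ℚ R] :
    (1 - X) * d⁄dX R (negLogOneSub R) = 1 := by
  have h : d⁄dX R (negLogOneSub R) = mk 1 := by
    ext n
    rw [coeff_derivative, negLogOneSub, coeff_mk, coeff_mk]
    have : ((n : R) + 1) = algebraMap ℚ R (n + 1) := by simp
    rw [this, ← map_mul]
    have h2 : (1 / ((n + 1 : ℕ) : ℚ)) * (n + 1) = 1 := by
      push_cast
      field_simp
    rw [h2]
    simp
  rw [h, mul_comm]
  exact mk_one_mul_one_sub_eq_one R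

/-- The chain rule for the logarithm, multiplied out because the coefficients will be Laurent
polynomials, which do not form a field. -/
theorem one_sub_mul_derivative_negLogOneSub_subst {R : Type*} [CommRing R] [Algebra ℚ R]
    {F : R⟦X⟧} (hF : constantCoeff F = 0) :
    (1 - F) * d⁄dX R ((negLogOneSub R).subst F) = d⁄dX R F := by
  have hs : HasSubst F := HasSubst.of_constantCoeff_zero' hF
  have h := congrArg (fun G : R⟦X⟧ => G.subst F) (one_sub_X_mul_derivative_negLogOneSub R)
  simp only [← coe_substAlgHom hs, map_mul, map_sub, map_one] at h
  simp only [coe_substAlgHom hs, subst_X hs] at h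
  rw [derivative_subst hs, ← mul_assoc, h, one_mul]

theorem constantCoeff_negLogOneSub_subst {R : Type*} [CommRing R] [Algebra ℚ R]
    {F : R⟦X⟧} (hF : constantCoeff F = 0) :
    constantCoeff ((negLogOneSub R).subst F) = 0 := by
  apply constantCoeff_subst_eq_zero hF
  simp [negLogOneSub, ← coeff_zero_eq_constantCoeff_apply]

/-- Since `F ^ k` has order at least `k`, only `k ≤ n` contribute. The term `k = 0` vanishes through
`1 / 0 = 0`. -/
theorem coeff_negLogOneSub_subst {R : Type*} [CommRing R] [Algebra ℚ R]
    {F : R⟦X⟧} (hF : constantCoeff F = 0) (n : ℕ) :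
    coeff n ((negLogOneSub R).subst F) =
      ∑ k ∈ Finset.range (n + 1), (1 / k : ℚ) • coeff n (F ^ k) := by
  rw [coeff_subst' (HasSubst.of_constantCoeff_zero' hF), finsum_eq_sum_of_support_subset]
  · refine Finset.sum_congr rfl fun k _ => ?_
    rw [negLogOneSub, coeff_mk, algebraMap_smul]
  · intro k hk
    rw [Finset.mem_coe, Finset.mem_range]
    by_contra hlt
    apply hk
    have : coeff n (F ^ k) = 0 := by
      apply coeff_of_lt_order
      refine lt_of_lt_of_le ?_ (le_order_pow_of_constantCoeff_eq_zero k hF)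
      exact_mod_cast (by omega : n < k)
    simp [this]

/-- The functional equation of the logarithm. -/
theorem negLogOneSub_subst_add {R : Type*} [CommRing R] [Algebra ℚ R]
    {F G A B : R⟦X⟧} (hF : constantCoeff F = 0) (hG : constantCoeff G = 0)
    (hA : constantCoeff A = 0) (hB : constantCoeff B = 0)
    (h : (1 - F) * (1 - G) = (1 - A) * (1 - B)) :
    (negLogOneSub R).subst F + (negLogOneSub R).subst G =
      (negLogOneSub R).subst A + (negLogOneSub R).subst B := by
  have : IsAddTorsionFree R := .of_module_rat R
  apply derivative.ext
  · have hu : IsUnit ((1 - F) * (1 - G)) := by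
      rw [isUnit_iff_constantCoeff]
      simp [hF, hG]
    have h1 := one_sub_mul_derivative_negLogOneSub_subst hF
    have h2 := one_sub_mul_derivative_negLogOneSub_subst hG
    have h3 := one_sub_mul_derivative_negLogOneSub_subst hA
    have h4 := one_sub_mul_derivative_negLogOneSub_subst hB
    have hd := congrArg (d⁄dX R) h
    have h10 : d⁄dX R (1 : R⟦X⟧) = 0 := derivative_one
    simp only [Derivation.leibniz, map_sub, smul_eq_mul, h10] at hd
    -- After multiplication by the unit `(1 - F) * (1 - G)`, all logarithmic derivatives become
    -- polynomial expressions, and the claim is the derivative of `h`.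
    apply hu.mul_left_cancel
    rw [map_add, map_add]
    linear_combination (1 - G) * h1 + (1 - F) * h2 - (1 - B) * h3 - (1 - A) * h4 - hd -
      (d⁄dX R ((negLogOneSub R).subst A) + d⁄dX R ((negLogOneSub R).subst B)) * h
  · simp [constantCoeff_negLogOneSub_subst, hF, hG, hA, hB]

theorem map_negLogOneSub_subst {R S : Type*} [CommRing R] [Algebra ℚ R] [CommRing S] [Algebra ℚ S]
    (f : R →+* S) {F : R⟦X⟧} (hF : constantCoeff F = 0) :
    PowerSeries.map f ((negLogOneSub R).subst F) =
      (negLogOneSub S).subst (PowerSeries.map f F) := by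
  have := map_subst (HasSubst.of_constantCoeff_zero' hF) (h := f) (negLogOneSub R)
  rw [map_negLogOneSub] at this
  exact this

/-- `exp (-log (1 - F)) (1 - F) = 1`, in the form of a logarithmic derivative. -/
theorem exp_subst_mul_eq {L D A : ℚ⟦X⟧} (hD : constantCoeff D = 1) (hA : constantCoeff A = 0)
    (hL : L + (negLogOneSub ℚ).subst (1 - D) = 2 * (negLogOneSub ℚ).subst A) :
    (PowerSeries.exp ℚ).subst L * (1 - A) ^ 2 = D := by
  have hD' : constantCoeff (1 - D) = 0 := by simp [hD]
  have h1 := one_sub_mul_derivative_negLogOneSub_subst hD'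
  have h2 := one_sub_mul_derivative_negLogOneSub_subst hA
  have hL0 : constantCoeff L = 0 := by
    have := congrArg constantCoeff hL
    simpa [constantCoeff_negLogOneSub_subst, hD', hA] using this
  have hs : HasSubst L := HasSubst.of_constantCoeff_zero' hL0
  have hE : d⁄dX ℚ ((PowerSeries.exp ℚ).subst L) = (PowerSeries.exp ℚ).subst L * d⁄dX ℚ L := by
    rw [derivative_subst hs, derivative_exp]
  have hE0 : constantCoeff ((PowerSeries.exp ℚ).subst L) = 1 := by
    -- Subtracting 1 makes the constant term of the outer series zero, as needed here.
    have h := constantCoeff_subst_eq_zero hL0 (PowerSeries.exp ℚ - 1) (by simp)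
    rw [← coe_substAlgHom hs, map_sub, map_one, coe_substAlgHom hs] at h
    have h' : constantCoeff ((PowerSeries.exp ℚ).subst L - 1) = 0 := h
    rw [map_sub, map_one, sub_eq_zero] at h'
    exact h'
  have hdL := congrArg (d⁄dX ℚ) hL
  set E := (PowerSeries.exp ℚ).subst L
  have h10 : d⁄dX ℚ (1 : ℚ⟦X⟧) = 0 := derivative_one
  have h20 : d⁄dX ℚ (2 : ℚ⟦X⟧) = 0 := by
    rw [← one_add_one_eq_two, map_add, h10, add_zero]
  simp only [map_add, map_sub, Derivation.leibniz, smul_eq_mul, h10, h20] at hdL h1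
  have hDi : D * D⁻¹ = 1 := PowerSeries.mul_inv_cancel D (by simp [hD])
  -- The quotient of the two sides has derivative 0 and constant term 1.
  suffices hW : E * (1 - A) ^ 2 * D⁻¹ = 1 by
    linear_combination D * hW - E * (1 - A) ^ 2 * hDi
  apply derivative.ext
  · have hd2 : d⁄dX ℚ ((1 - A) ^ 2) = - 2 * (1 - A) * d⁄dX ℚ A := by
      rw [pow_two, Derivation.leibniz]
      simp only [map_sub, h10, smul_eq_mul]
      ring
    rw [Derivation.leibniz, Derivation.leibniz, derivative_inv', h10, hE, hd2]
    simp only [smul_eq_mul]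
    have hx : D * ((1 - A) * d⁄dX ℚ L - 2 * d⁄dX ℚ A) = (1 - A) * d⁄dX ℚ D := by
      linear_combination (1 - A) * D * hdL - (1 - A) * h1 + 2 * D * h2
    linear_combination E * (1 - A) * D⁻¹ ^ 2 * hx - (E * (1 - A) * D⁻¹ *
      ((1 - A) * d⁄dX ℚ L - 2 * d⁄dX ℚ A)) * hDi
  · simp [hE0, hA, hD]

end NegLog

/-! ### A linear functional on Laurent polynomials -/

section Functional

open PowerSeries
open scoped LaurentPolynomial

/-- The linear functional on Laurent polynomials that sends `T ^ i` to `N ^ max i 0`. -/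
noncomputable def laurentMaxEval (N : ℚ) : ℚ[T;T⁻¹] →+ ℚ where
  toFun p := p.coeff.sum fun i a => a * N ^ i.toNat
  map_zero' := by simp
  map_add' p q := by
    rw [AddMonoidAlgebra.coeff_add, Finsupp.sum_add_index'] <;> simp [add_mul]

theorem laurentMaxEval_apply (N : ℚ) (p : ℚ[T;T⁻¹]) :
    laurentMaxEval N p = p.coeff.sum fun i a => a * N ^ i.toNat := rfl

theorem laurentMaxEval_C_mul_T (N a : ℚ) (i : ℤ) :
    laurentMaxEval N (LaurentPolynomial.C a * LaurentPolynomial.T i) = a * N ^ i.toNat := by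
  rw [← LaurentPolynomial.single_eq_C_mul_T, laurentMaxEval_apply, AddMonoidAlgebra.coeff_single,
    Finsupp.sum_single_index (by simp)]

/-- On nonnegative exponents the maximum is the exponent itself, so the functional restricts to a
ring homomorphism and commutes with the logarithm. On nonpositive exponents, treated next, the same
holds with evaluation at 1. -/
theorem laurentMaxEval_toLaurent (N : ℚ) (p : Polynomial ℚ) :
    laurentMaxEval N (Polynomial.toLaurent p) = p.eval N := by
  induction p using Polynomial.induction_on' with
  | add p q hp hq => simp [hp, hq]
  | monomial n a =>
    rw [Polynomial.toLaurent_C_mul_T, laurentMaxEval_C_mul_T]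
    simp

theorem laurentMaxEval_invert_toLaurent (N : ℚ) (p : Polynomial ℚ) :
    laurentMaxEval N (LaurentPolynomial.invert (Polynomial.toLaurent p)) = p.eval 1 := by
  induction p using Polynomial.induction_on' with
  | add p q hp hq => simp [hp, hq]
  | monomial n a =>
    rw [Polynomial.toLaurent_C_mul_T, map_mul, LaurentPolynomial.invert_T,
      LaurentPolynomial.invert_C, laurentMaxEval_C_mul_T]
    simp

theorem laurentMaxEval_smul (N q : ℚ) (p : ℚ[T;T⁻¹]) :
    laurentMaxEval N (q • p) = q * laurentMaxEval N p := by
  rw [laurentMaxEval_apply, laurentMaxEval_apply, AddMonoidAlgebra.coeff_smul, Finsupp.sum_smul_index (by simp), Finsupp.mul_sum]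
  simp [mul_assoc]

end Functional

/-! ### The Dyck series and the Wiener–Hopf factorisation -/

section DyckSeries

open PowerSeries
open scoped LaurentPolynomial

/-- The generating series of the Dyck words with inserted circles. -/
theorem exists_dyckSeries (N J : ℚ) {Q : ℕ} (hQ : 1 ≤ Q) :
    ∃ D : ℚ⟦X⟧, constantCoeff D = 1 ∧
      D * (1 - C J * X ^ Q) = 1 + C N * X ^ 2 * D ^ 2 := by
  have hu : constantCoeff (1 - C J * X ^ Q) = 1 := by
    simp [show Q ≠ 0 by omega]
  -- Writing `D = v c` turns the equation for `D` into the Catalan equation `c = 1 + t c²` at `t = N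
  -- X² v²`.
  set v : ℚ⟦X⟧ := (1 - C J * X ^ Q)⁻¹ with hv
  have hvu : (1 - C J * X ^ Q) * v = 1 := PowerSeries.mul_inv_cancel _ (by simp [hu])
  have hg : constantCoeff (C N * X ^ 2 * v ^ 2) = 0 := by simp
  have hs : HasSubst (C N * X ^ 2 * v ^ 2) := HasSubst.of_constantCoeff_zero' hg
  set c : ℚ⟦X⟧ := PowerSeries.map (Nat.castRingHom ℚ) catalanSeries
  have hc : c ^ 2 * X + 1 = c := by
    have := congrArg (PowerSeries.map (Nat.castRingHom ℚ)) catalanSeries_sq_mul_X_add_one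
    simpa using this
  have hc' := congrArg (fun G : ℚ⟦X⟧ => G.subst (C N * X ^ 2 * v ^ 2)) hc
  simp only [← coe_substAlgHom hs, map_mul, map_add, map_one, map_pow] at hc'
  simp only [coe_substAlgHom hs, subst_X hs] at hc'
  have h0 : constantCoeff (c.subst (C N * X ^ 2 * v ^ 2) : ℚ⟦X⟧) = 1 := by
    have := congrArg constantCoeff hc'
    rw [← this]
    simp
  refine ⟨v * c.subst (C N * X ^ 2 * v ^ 2), ?_, ?_⟩
  · simp only [map_mul, h0]
    simp [hv, hu]
  · linear_combination c.subst (C N * X ^ 2 * v ^ 2) * hvu - hc'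

/-- Applying `laurentMaxEval` coefficientwise to the logarithm of the generating series of all
words in the loops and circles. -/
theorem laurentMaxEval_coeff_negLogOneSub (N J : ℚ) {Q : ℕ} (hQ : 1 ≤ Q) {D : ℚ⟦X⟧}
    (hD : constantCoeff D = 1) (hDeq : D * (1 - C J * X ^ Q) = 1 + C N * X ^ 2 * D ^ 2) :
    PowerSeries.mk (fun n => laurentMaxEval N (coeff n ((negLogOneSub ℚ[T;T⁻¹]).subst
      (C (LaurentPolynomial.T 1) * X + C (LaurentPolynomial.C N * LaurentPolynomial.T (-1)) * X +
        C (LaurentPolynomial.C J) * X ^ Q)))) + (negLogOneSub ℚ).subst (1 - D) =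
      2 * (negLogOneSub ℚ).subst (C N * X * D) := by
  set ι : ℚ →+* ℚ[T;T⁻¹] := LaurentPolynomial.C
  set F : ℚ[T;T⁻¹]⟦X⟧ := C (LaurentPolynomial.T 1) * X +
    C (LaurentPolynomial.C N * LaurentPolynomial.T (-1)) * X + C (LaurentPolynomial.C J) * X ^ Q
  -- The terms `T X D` and `N T⁻¹ X D` are lifted to polynomial coefficients; `f` and `g` send the
  -- polynomial variable to `T` and to `T⁻¹`.
  set pA : (Polynomial ℚ)⟦X⟧ := C Polynomial.X * X * PowerSeries.map Polynomial.C D with hpA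
  set pB : (Polynomial ℚ)⟦X⟧ :=
    C (Polynomial.C N * Polynomial.X) * X * PowerSeries.map Polynomial.C D with hpB
  set f : Polynomial ℚ →+* ℚ[T;T⁻¹] := Polynomial.toLaurent with hf
  set g : Polynomial ℚ →+* ℚ[T;T⁻¹] :=
    (LaurentPolynomial.invert (R := ℚ) : ℚ[T;T⁻¹] →+* ℚ[T;T⁻¹]).comp Polynomial.toLaurent with hg
  have hfC : f.comp Polynomial.C = ι := by ext x; simp [hf, ι]
  have hgC : g.comp Polynomial.C = ι := by ext x; simp [hg, ι]
  have hF : constantCoeff F = 0 := by simp [F, show Q ≠ 0 by omega]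
  have hA : constantCoeff pA = 0 := by simp [hpA]
  have hB : constantCoeff pB = 0 := by simp [hpB]
  have hG : constantCoeff (1 - D) = 0 := by simp [hD]
  have mapzero : ∀ {R S : Type} [CommRing R] [CommRing S] (h : R →+* S) (P : R⟦X⟧),
      constantCoeff P = 0 → constantCoeff (PowerSeries.map h P) = 0 := by
    intro R S _ _ h P hP
    rw [← coeff_zero_eq_constantCoeff_apply, coeff_map, coeff_zero_eq_constantCoeff_apply, hP,
      map_zero]
  have hcomp : ∀ {S : Type} [CommRing S] (h : Polynomial ℚ →+* S),
      PowerSeries.map h (PowerSeries.map Polynomial.C D) =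
        PowerSeries.map (h.comp Polynomial.C) D := by
    intro S _ h
    ext n
    simp
  have hmA : PowerSeries.map f pA = C (LaurentPolynomial.T 1) * X * PowerSeries.map ι D := by
    rw [hpA, map_mul, hcomp, hfC]
    simp [hf]
  have hmB : PowerSeries.map g pB =
      C (ι N * LaurentPolynomial.T (-1)) * X * PowerSeries.map ι D := by
    rw [hpB, map_mul, hcomp, hgC]
    simp [hg, ι]
  -- The logarithm of `(1 - F) D = (1 - T X D) (1 - N T⁻¹ X D)`. The mixed term of the product is `N
  -- X² D²`, so this identity is the equation for `D`.
  have key := negLogOneSub_subst_add (R := ℚ[T;T⁻¹]) hF (mapzero ι _ hG) (mapzero f _ hA)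
    (mapzero g _ hB) (by
      rw [hmA, hmB]
      have h := congrArg (PowerSeries.map ι) hDeq
      simp only [map_mul, map_sub, map_one, map_pow, map_add, PowerSeries.map_C,
        PowerSeries.map_X] at h ⊢
      have hT : (C (LaurentPolynomial.T 1 : ℚ[T;T⁻¹]) : ℚ[T;T⁻¹]⟦X⟧) *
          C (LaurentPolynomial.T (-1)) = 1 := by
        rw [← map_mul, ← LaurentPolynomial.T_add]
        simp
      simp only [F, map_mul]
      linear_combination h - X ^ 2 * (PowerSeries.map ι) D ^ 2 * C (ι N) * hT)
  rw [← map_negLogOneSub_subst ι hG, ← map_negLogOneSub_subst f hA,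
    ← map_negLogOneSub_subst g hB] at key
  -- Evaluation at `N` on one side and at 1 on the other give the same series, whence the factor 2
  -- in the conclusion.
  have hevA : PowerSeries.map (Polynomial.evalRingHom N) pA = C N * X * D := by
    rw [hpA, map_mul, hcomp, Subsingleton.elim (RingHom.comp _ _) (RingHom.id ℚ)]
    simp
  have hevB : PowerSeries.map (Polynomial.evalRingHom 1) pB = C N * X * D := by
    rw [hpB, map_mul, hcomp, Subsingleton.elim (RingHom.comp _ _) (RingHom.id ℚ)]
    simp
  ext n
  have h := congrArg (fun P => laurentMaxEval N (coeff n P)) key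
  simp only [map_add, coeff_map] at h
  have h1 : ∀ q : ℚ, laurentMaxEval N (ι q) = q := fun q => by
    simpa [ι] using laurentMaxEval_C_mul_T N q 0
  have h2 : ∀ p, laurentMaxEval N (f p) = p.eval N := laurentMaxEval_toLaurent N
  have h3 : ∀ p, laurentMaxEval N (g p) = p.eval 1 := laurentMaxEval_invert_toLaurent N
  rw [h1, h2, h3, ← Polynomial.coe_evalRingHom, ← Polynomial.coe_evalRingHom, ← coeff_map,
    ← coeff_map, map_negLogOneSub_subst _ hA, map_negLogOneSub_subst _ hB, hevA, hevB] at h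
  rw [two_mul, map_add, map_add, coeff_mk, h]

end DyckSeries

/-! ### Solving the quadratic equation for the Dyck series -/

section ClosedForm

open PowerSeries

/-- From the logarithm of the zeta function to its closed form. -/
theorem exists_sqrt_closedForm (N J : ℚ) {Q : ℕ} (hQ : 1 ≤ Q) {L D : ℚ⟦X⟧}
    (hD : constantCoeff D = 1) (hDeq : D * (1 - C J * X ^ Q) = 1 + C N * X ^ 2 * D ^ 2)
    (hL : L + (negLogOneSub ℚ).subst (1 - D) = 2 * (negLogOneSub ℚ).subst (C N * X * D)) :
    ∃ S : ℚ⟦X⟧, constantCoeff S = 1 ∧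
      S ^ 2 = (1 - C J * X ^ Q) ^ 2 - 4 * C N * X ^ 2 ∧
      (PowerSeries.exp ℚ).subst L * (1 - C J * X ^ Q - 2 * C N * X + S) ^ 2 =
        2 * (1 - C J * X ^ Q + S) := by
  have hQ0 : Q ≠ 0 := by omega
  -- The quadratic formula read backwards: `2 N X² D = 1 - J X ^ Q - S`, and the discriminant is
  -- `S²`.
  refine ⟨1 - C J * X ^ Q - 2 * C N * X ^ 2 * D, by simp [hQ0], ?_, ?_⟩
  · linear_combination (-4 * C N * X ^ 2) * hDeq
  · have h := exp_subst_mul_eq hD (by simp) hL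
    have hDi : D * D⁻¹ = 1 := PowerSeries.mul_inv_cancel D (by simp [hD])
    set E := (PowerSeries.exp ℚ).subst L
    set u := (C J * X ^ Q : ℚ⟦X⟧)
    have h1 : 1 - u + (1 - u - 2 * C N * X ^ 2 * D) = 2 * D⁻¹ := by
      linear_combination 2 * D⁻¹ * hDeq - (2 * (1 - u) - 2 * C N * X ^ 2 * D) * hDi
    have h2 : 1 - u - 2 * C N * X + (1 - u - 2 * C N * X ^ 2 * D) =
        2 * D⁻¹ * (1 - C N * X * D) := by
      linear_combination h1 + 2 * C N * X * hDi
    rw [h1, h2]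
    linear_combination 4 * D⁻¹ ^ 2 * h + 4 * D⁻¹ * hDi

end ClosedForm

/-! ### Power series as Taylor series of functions of a complex variable -/

section Taylor

open PowerSeries Filter Topology

/-- The function `f` is near `0` the sum of the power series `F`. -/
def HasTaylorSeriesAtZero (F : ℂ⟦X⟧) (f : ℂ → ℂ) : Prop :=
  ∀ᶠ z in 𝓝 (0 : ℂ), HasSum (fun n => coeff n F * z ^ n) (f z)

namespace HasTaylorSeriesAtZero

variable {F G : ℂ⟦X⟧} {f g : ℂ → ℂ}

theorem iff_hasFPowerSeriesAt : HasTaylorSeriesAtZero F f ↔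
    HasFPowerSeriesAt f (FormalMultilinearSeries.ofScalars ℂ fun n => coeff n F) 0 := by
  rw [hasFPowerSeriesAt_iff]
  simp [HasTaylorSeriesAtZero, mul_comm]

theorem analyticAt (h : HasTaylorSeriesAtZero F f) : AnalyticAt ℂ f 0 :=
  (iff_hasFPowerSeriesAt.1 h).analyticAt

theorem of_analyticAt (h : AnalyticAt ℂ f 0) :
    HasTaylorSeriesAtZero (mk fun n => iteratedDeriv n f 0 / n.factorial) f := by
  rw [iff_hasFPowerSeriesAt]
  simpa using h.hasFPowerSeriesAt

theorem unique (hF : HasTaylorSeriesAtZero F f) (hG : HasTaylorSeriesAtZero G f) : F = G := by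
  have h := (iff_hasFPowerSeriesAt.1 hF).eq_formalMultilinearSeries (iff_hasFPowerSeriesAt.1 hG)
  ext n
  have := congrArg (fun p => FormalMultilinearSeries.coeff p n) h
  simpa using this

theorem congr (hF : HasTaylorSeriesAtZero F f) (h : f =ᶠ[𝓝 0] g) : HasTaylorSeriesAtZero F g := by
  filter_upwards [hF, h] with z hz hfg
  rwa [← hfg]

theorem eventuallyEq (hF : HasTaylorSeriesAtZero F f) (hG : HasTaylorSeriesAtZero F g) :
    f =ᶠ[𝓝 0] g := by
  filter_upwards [hF, hG] with z hz hz'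
  exact hz.unique hz'

theorem add (hF : HasTaylorSeriesAtZero F f) (hG : HasTaylorSeriesAtZero G g) :
    HasTaylorSeriesAtZero (F + G) (fun z => f z + g z) := by
  filter_upwards [hF, hG] with z hz hz'
  simpa [add_mul] using hz.add hz'

theorem mul (hF : HasTaylorSeriesAtZero F f) (hG : HasTaylorSeriesAtZero G g) :
    HasTaylorSeriesAtZero (F * G) (fun z => f z * g z) := by
  filter_upwards [hF, hG] with z hz hz'
  have hs : Summable fun n => ‖coeff n F * z ^ n‖ := hz.summable.norm
  have hs' : Summable fun n => ‖coeff n G * z ^ n‖ := hz'.summable.norm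
  have h := tsum_mul_tsum_eq_tsum_sum_antidiagonal_of_summable_norm hs hs'
  have hsum := (summable_norm_sum_mul_antidiagonal_of_summable_norm hs hs').of_norm.hasSum
  rw [← h, hz.tsum_eq, hz'.tsum_eq] at hsum
  refine (congrArg (fun s => HasSum s (f z * g z)) (funext fun n => ?_)).mpr hsum
  rw [coeff_mul, Finset.sum_mul]
  refine Finset.sum_congr rfl fun p hp => ?_
  rw [← Finset.HasAntidiagonal.mem_antidiagonal.1 hp, pow_add]
  ring

theorem const (c : ℂ) : HasTaylorSeriesAtZero (C c) (fun _ => c) := by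
  refine Eventually.of_forall fun z => ?_
  convert hasSum_single (f := fun n => coeff n (C c) * z ^ n) 0 ?_ using 1
  · simp
  · intro n hn
    simp [coeff_C, hn]

theorem id : HasTaylorSeriesAtZero X (fun z => z) := by
  refine Eventually.of_forall fun z => ?_
  convert hasSum_single (f := fun n => coeff n (X : ℂ⟦X⟧) * z ^ n) 1 ?_ using 1
  · simp
  · intro n hn
    simp [coeff_X, hn]

theorem pow (hF : HasTaylorSeriesAtZero F f) (k : ℕ) :
    HasTaylorSeriesAtZero (F ^ k) (fun z => f z ^ k) := by
  induction k with
  | zero => simpa using const 1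
  | succ k ih => simpa only [pow_succ] using ih.mul hF

theorem neg (hF : HasTaylorSeriesAtZero F f) : HasTaylorSeriesAtZero (-F) (fun z => -f z) := by
  simpa using (const (-1)).mul hF

theorem sub (hF : HasTaylorSeriesAtZero F f) (hG : HasTaylorSeriesAtZero G g) :
    HasTaylorSeriesAtZero (F - G) (fun z => f z - g z) := by
  simpa only [sub_eq_add_neg] using hF.add hG.neg

theorem deriv (hF : HasTaylorSeriesAtZero F f) :
    HasTaylorSeriesAtZero (d⁄dX ℂ F) (deriv f) := by
  have h := of_analyticAt hF.analyticAt.deriv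
  convert h using 1
  rw [hF.unique (of_analyticAt hF.analyticAt)]
  ext n
  rw [coeff_derivative, coeff_mk, coeff_mk, iteratedDeriv_succ', Nat.factorial_succ]
  have : (n.factorial : ℂ) ≠ 0 := by exact_mod_cast n.factorial_ne_zero
  have : ((n : ℂ) + 1) ≠ 0 := by exact_mod_cast n.succ_ne_zero
  push_cast
  field_simp

theorem constantCoeff_eq (hF : HasTaylorSeriesAtZero F f) : constantCoeff F = f 0 := by
  have h := hF.self_of_nhds
  refine HasSum.unique ?_ h
  convert hasSum_single (f := fun n => coeff n F * (0 : ℂ) ^ n) 0 ?_ using 1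
  · simp
  · intro n hn
    simp [hn]

/-- Substitution into the exponential series. -/
theorem exp (hF : HasTaylorSeriesAtZero F f) (h0 : constantCoeff F = 0) :
    HasTaylorSeriesAtZero ((PowerSeries.exp ℂ).subst F) (fun z => Complex.exp (f z)) := by
  have hs : HasSubst F := HasSubst.of_constantCoeff_zero' h0
  have han : AnalyticAt ℂ (fun z => Complex.exp (f z)) 0 := hF.analyticAt.cexp
  have hE := of_analyticAt han
  set E : ℂ⟦X⟧ := mk fun n => iteratedDeriv n (fun z => Complex.exp (f z)) 0 / n.factorial
  have hd : _root_.deriv (fun z => Complex.exp (f z)) =ᶠ[𝓝 0]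
      fun z => Complex.exp (f z) * _root_.deriv f z := by
    filter_upwards [hF.analyticAt.eventually_analyticAt] with z hz
    exact (hz.differentiableAt.hasDerivAt.cexp).deriv
  have hE' : d⁄dX ℂ E = E * d⁄dX ℂ F := (hE.deriv.congr hd).unique (hE.mul hF.deriv)
  have hE0 : constantCoeff E = 1 := by
    rw [hE.constantCoeff_eq, ← hF.constantCoeff_eq, h0, Complex.exp_zero]
  convert hE using 1
  set P : ℂ⟦X⟧ := (PowerSeries.exp ℂ).subst F with hP
  have hP' : d⁄dX ℂ P = P * d⁄dX ℂ F := by rw [hP, derivative_subst hs, derivative_exp]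
  have hP0 : constantCoeff P = 1 := by
    have h := constantCoeff_subst_eq_zero h0 (PowerSeries.exp ℂ - 1) (by simp)
    rw [← coe_substAlgHom hs, map_sub, map_one, coe_substAlgHom hs] at h
    have h' : constantCoeff (P - 1) = 0 := h
    rw [map_sub, map_one, sub_eq_zero] at h'
    exact h'
  have hi : E * E⁻¹ = 1 := PowerSeries.mul_inv_cancel E (by simp [hE0])
  -- The formal and the analytic exponential both solve `Y' = Y F'` with constant term 1, so their
  -- quotient is constant.
  suffices h : P * E⁻¹ = 1 by linear_combination E * h - P * hi
  apply derivative.ext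
  · rw [Derivation.leibniz, derivative_inv', hE', hP', derivative_one]
    simp only [smul_eq_mul]
    linear_combination (-P * E⁻¹ * d⁄dX ℂ F) * hi
  · simp [hE0, hP0]

end HasTaylorSeriesAtZero

/-- Two power series with the same square and the same nonzero constant term agree. -/
theorem eq_of_sq_eq_sq_of_constantCoeff {R : Type*} [CommRing R] [IsDomain R] {S T : R⟦X⟧}
    (h : S ^ 2 = T ^ 2) (h0 : constantCoeff S + constantCoeff T ≠ 0) : S = T := by
  rcases sq_eq_sq_iff_eq_or_eq_neg.1 h with h | h
  · exact h
  · exact absurd (by simp [h]) h0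

/-- Transfer of the closed form from formal power series to functions near `0`. -/
theorem closedForm_of_formal (N J : ℕ) {Q : ℕ} (hQ : 1 ≤ Q) {c : ℕ → ℚ} (hc0 : c 0 = 0)
    {B : ℝ} (hB : 0 < B) (hc : ∀ n, |(c n : ℝ)| ≤ B ^ n) {S : ℚ⟦X⟧}
    (hS0 : constantCoeff S = 1)
    (hS : S ^ 2 = (1 - (J : ℚ⟦X⟧) * X ^ Q) ^ 2 - 4 * (N : ℚ⟦X⟧) * X ^ 2)
    (hE : (PowerSeries.exp ℚ).subst (mk c) * (1 - (J : ℚ⟦X⟧) * X ^ Q - 2 * (N : ℚ⟦X⟧) * X + S) ^ 2 =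
      2 * (1 - (J : ℚ⟦X⟧) * X ^ Q + S)) :
    ∀ᶠ z : ℂ in 𝓝 0,
      Summable (fun n : ℕ => (c n : ℂ) * z ^ n) ∧
      1 - J * z ^ Q - 2 * N * z + Complex.sqrt ((1 - J * z ^ Q) ^ 2 - 4 * N * z ^ 2) ≠ 0 ∧
      Complex.exp (∑' n : ℕ, (c n : ℂ) * z ^ n) =
        2 * (1 - J * z ^ Q + Complex.sqrt ((1 - J * z ^ Q) ^ 2 - 4 * N * z ^ 2)) /
          (1 - J * z ^ Q - 2 * N * z +
            Complex.sqrt ((1 - J * z ^ Q) ^ 2 - 4 * N * z ^ 2)) ^ 2 := by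
  have hQ0 : Q ≠ 0 := by omega
  have hsum : ∀ᶠ z : ℂ in 𝓝 0, Summable (fun n : ℕ => (c n : ℂ) * z ^ n) := by
    filter_upwards [Metric.ball_mem_nhds (0 : ℂ) (inv_pos.2 hB)] with z hz
    have hz' : B * ‖z‖ < 1 := by
      rw [mem_ball_zero_iff] at hz
      calc B * ‖z‖ < B * B⁻¹ := by gcongr
        _ = 1 := mul_inv_cancel₀ hB.ne'
    refine Summable.of_norm_bounded (summable_geometric_of_lt_one (by positivity) hz') fun n => ?_
    rw [norm_mul, norm_pow, mul_pow]
    gcongr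
    refine le_trans (le_of_eq ?_) (hc n)
    rw [← Complex.ofReal_ratCast, Complex.norm_real, Real.norm_eq_abs]
  set κ : ℚ →+* ℂ := algebraMap ℚ ℂ
  set L : ℂ⟦X⟧ := PowerSeries.map κ (mk c) with hLdef
  have hL : HasTaylorSeriesAtZero L (fun z => ∑' n : ℕ, (c n : ℂ) * z ^ n) := by
    filter_upwards [hsum] with z hz
    convert hz.hasSum using 3 with n
    simp [L, κ]
  have hL0 : constantCoeff L = 0 := by
    rw [hL.constantCoeff_eq, tsum_eq_single 0]
    · simp [hc0]
    · intro n hn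
      simp [hn]
  set r : ℂ → ℂ := fun z => (1 - J * z ^ Q) ^ 2 - 4 * N * z ^ 2 with hr
  have hcN : ∀ m : ℕ, HasTaylorSeriesAtZero (m : ℂ⟦X⟧) (fun _ => (m : ℂ)) := fun m => by
    simpa using HasTaylorSeriesAtZero.const (m : ℂ)
  have hc1 : HasTaylorSeriesAtZero (1 : ℂ⟦X⟧) (fun _ => 1) := by simpa using hcN 1
  have hc2 : HasTaylorSeriesAtZero (2 : ℂ⟦X⟧) (fun _ => 2) := by simpa using hcN 2
  have hc4 : HasTaylorSeriesAtZero (4 : ℂ⟦X⟧) (fun _ => 4) := by simpa using hcN 4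
  have hX := HasTaylorSeriesAtZero.id
  have h1u := hc1.sub ((hcN J).mul (hX.pow Q))
  have hrT := (h1u.pow 2).sub ((hc4.mul (hcN N)).mul (hX.pow 2))
  have hr0 : r 0 = 1 := by simp [hr, hQ0]
  have hran : AnalyticAt ℂ (fun z => Complex.sqrt (r z)) 0 := by
    have hra : AnalyticAt ℂ r 0 := hrT.analyticAt
    have h : AnalyticAt ℂ (fun z => r z ^ (1 / 2 : ℂ)) 0 :=
      hra.cpow analyticAt_const (by rw [hr0]; exact Complex.one_mem_slitPlane)
    simpa [Complex.sqrt] using h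
  have hsq : ∀ w : ℂ, Complex.sqrt w ^ 2 = w := fun w => by
    simp [Complex.sqrt]
  have hST := HasTaylorSeriesAtZero.of_analyticAt hran
  set T : ℂ⟦X⟧ := mk fun n => iteratedDeriv n (fun z => Complex.sqrt (r z)) 0 / n.factorial
  have hsqrt0 : Complex.sqrt (r 0) = 1 := by
    rw [hr0]
    simp [Complex.sqrt]
  -- The Taylor series of the principal root and the formal root both square to the series of `r`
  -- and both have constant term 1.
  have hTS : T = PowerSeries.map κ S := by
    apply eq_of_sq_eq_sq_of_constantCoeff
    · have h1 := congrArg (PowerSeries.map κ) hS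
      simp only [map_sub, map_mul, map_pow, map_one, map_natCast, PowerSeries.map_X,
        map_ofNat] at h1
      rw [h1]
      refine (hST.pow 2).unique ?_
      simpa only [hsq] using hrT
    · have : constantCoeff (PowerSeries.map κ S) = 1 := by
        rw [← coeff_zero_eq_constantCoeff_apply, coeff_map, coeff_zero_eq_constantCoeff_apply, hS0,
          map_one]
      rw [hST.constantCoeff_eq, this, hsqrt0]
      norm_num
  have hEc := congrArg (PowerSeries.map κ) hE
  have hexp : PowerSeries.map κ ((PowerSeries.exp ℚ).subst (mk c)) =
      (PowerSeries.exp ℂ).subst L := by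
    have h := map_subst (HasSubst.of_constantCoeff_zero' (a := (mk c : ℚ⟦X⟧)) (by
      rw [← coeff_zero_eq_constantCoeff_apply, coeff_mk, hc0])) (h := κ) (PowerSeries.exp ℚ)
    rw [map_exp] at h
    exact h
  simp only [map_sub, map_mul, map_pow, map_one, map_natCast, PowerSeries.map_X, map_ofNat,
    map_add, hexp, ← hTS] at hEc
  have hden := (h1u.sub ((hc2.mul (hcN N)).mul hX)).add hST
  have hlhs := (hL.exp hL0).mul (hden.pow 2)
  rw [hEc] at hlhs
  have hfin := hlhs.eventuallyEq (hc2.mul (h1u.add hST))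
  -- The denominator takes the value 2 at the origin.
  have hne := hden.analyticAt.continuousAt.eventually_ne (y := 0) (by
    simp only [hsqrt0]
    simp [hQ0])
  filter_upwards [hsum, hne, hfin] with z h1 h2 h3
  exact ⟨h1, h2, by rw [eq_div_iff (pow_ne_zero 2 h2)]; exact h3⟩

end Taylor

/-! ### Products in the Dyck inverse monoid -/

namespace DyckMonoid

variable {Γ : Type*}

theorem induction_cons {p : DyckMonoid Γ → Prop} (h1 : p 1)
    (hmul : ∀ g m, p m → p (PresentedMonoid.of (DyckRel Γ) g * m)) (m : DyckMonoid Γ) : p m := by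
  induction m using PresentedMonoid.inductionOn with
  | _ w =>
    induction w using FreeMonoid.inductionOn' with
    | one => exact h1
    | of_mul g w ih => exact hmul g _ ih

theorem zero_mul (m : DyckMonoid Γ) : zero Γ * m = zero Γ := by
  induction m using induction_cons with
  | h1 => rw [mul_one]
  | hmul g m ih =>
    rw [← mul_assoc]
    have : zero Γ * PresentedMonoid.of (DyckRel Γ) g = zero Γ :=
      PresentedMonoid.mk_eq_mk_of_rel (DyckRel.zero_mul g)
    rw [this, ih]

theorem mul_zero (m : DyckMonoid Γ) : m * zero Γ = zero Γ := by
  induction m using induction_cons with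
  | h1 => rw [one_mul]
  | hmul g m ih =>
    rw [mul_assoc, ih]
    exact PresentedMonoid.mk_eq_mk_of_rel (DyckRel.mul_zero g)

theorem neg_mul_pos (γ : Γ) :
    (MotzkinSymbol.neg γ).val * (MotzkinSymbol.pos γ).val = (1 : DyckMonoid Γ) :=
  PresentedMonoid.mk_eq_mk_of_rel (DyckRel.neg_mul_pos γ)

theorem neg_mul_pos_of_ne {γ γ' : Γ} (h : γ ≠ γ') :
    (MotzkinSymbol.neg γ).val * (MotzkinSymbol.pos γ').val = zero Γ :=
  PresentedMonoid.mk_eq_mk_of_rel (DyckRel.neg_mul_pos_of_ne γ γ' h)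

theorem end_mul_apply {α : Type*} (f g : Function.End α) (x : α) : (f * g) x = f (g x) := rfl

theorem end_one_apply {α : Type*} (x : α) : (1 : Function.End α) x = x := rfl

open Classical in
/-- The action of the generators on stacks: `γ(+)` pushes `γ`, and `γ(-)` removes `γ` from the
top of the stack if it is there, and fails otherwise. -/
noncomputable def stackGen : DyckGen Γ → Function.End (Option (List Γ))
  | .neg γ => fun s => s.bind fun l => if l.head? = some γ then some l.tail else none
  | .pos γ => fun s => s.map (γ :: ·)
  | .zero => fun _ => none

/-- The representation of the Dyck inverse monoid by partial maps of the set of stacks. -/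
noncomputable def stackHom : DyckMonoid Γ →* Function.End (Option (List Γ)) :=
  PresentedMonoid.lift stackGen (by
    intro a b h
    cases h with
    | neg_mul_pos γ =>
      funext s
      change stackGen (.neg γ) (stackGen (.pos γ) s) = s
      cases s <;> simp [stackGen]
    | neg_mul_pos_of_ne γ γ' h =>
      funext s
      change stackGen (.neg γ) (stackGen (.pos γ') s) = none
      cases s <;> simp [stackGen, Ne.symm h]
    | zero_mul g => rfl
    | mul_zero g =>
      funext s
      change stackGen g none = none
      cases g <;> simp [stackGen])

theorem stackHom_zero (s : Option (List Γ)) : stackHom (zero Γ) s = none := by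
  simp [zero, stackHom, stackGen]

theorem stackHom_pos (γ : Γ) (l : List Γ) :
    stackHom (MotzkinSymbol.pos γ).val (some l) = some (γ :: l) := by
  simp [MotzkinSymbol.val, stackHom, stackGen]

theorem stackHom_neg (γ : Γ) (l : List Γ) :
    stackHom (MotzkinSymbol.neg γ).val (some (γ :: l)) = some l := by
  simp [MotzkinSymbol.val, stackHom, stackGen]

/-- An element of the Dyck inverse monoid is nonnilpotent if none of its powers is zero. -/
def IsNonnilpotent (m : DyckMonoid Γ) : Prop := ∀ k : ℕ, m ^ k ≠ zero Γ

/-- From `(ab)^(k+1) = a (ba)^k b`: a zero power of `ba` would produce one of `ab`. Thus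
admissibility of a period word does not depend on where the period begins. -/
theorem IsNonnilpotent.mul_comm {a b : DyckMonoid Γ} (h : IsNonnilpotent (a * b)) :
    IsNonnilpotent (b * a) := by
  intro k hk
  apply h (k + 1)
  have : (a * b) ^ (k + 1) = a * (b * a) ^ k * b := by
    rw [mul_assoc, mul_pow_mul, ← mul_assoc, pow_succ']
  rw [this, hk, mul_zero, zero_mul]

theorem not_isNonnilpotent_zero_mul (a : DyckMonoid Γ) : ¬ IsNonnilpotent (zero Γ * a) := by
  intro h
  apply h 1
  rw [pow_one, zero_mul]

/-- Pushing on a stack never fails, whereas zero acts as the map that always fails. -/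
theorem prod_pos_ne_zero (l : List Γ) :
    (l.map fun γ => (MotzkinSymbol.pos γ).val).prod ≠ zero Γ := by
  suffices h : ∃ s, stackHom (l.map fun γ => (MotzkinSymbol.pos γ).val).prod (some []) = some s by
    intro h0
    obtain ⟨s, hs⟩ := h
    rw [h0, stackHom_zero] at hs
    cases hs
  induction l with
  | nil => exact ⟨[], by simp [end_one_apply]⟩
  | cons γ l ih =>
    obtain ⟨s, hs⟩ := ih
    refine ⟨γ :: s, ?_⟩
    rw [List.map_cons, List.prod_cons, map_mul, end_mul_apply, hs,
      stackHom_pos]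

/-- The rightmost factor acts first, so the word succeeds on the stack that holds its letters in
reverse order. The remainder `t` is there for the induction. -/
theorem prod_neg_ne_zero (l : List Γ) :
    (l.map fun γ => (MotzkinSymbol.neg γ).val).prod ≠ zero Γ := by
  suffices h : ∀ t, stackHom (l.map fun γ => (MotzkinSymbol.neg γ).val).prod
      (some (l.reverse ++ t)) = some t by
    intro h0
    have hs := h []
    rw [h0, stackHom_zero] at hs
    cases hs
  induction l with
  | nil => intro t; simp [end_one_apply]
  | cons γ l ih =>
    intro t
    rw [List.map_cons, List.prod_cons, map_mul, end_mul_apply,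
      List.reverse_cons, List.append_assoc, ih, List.singleton_append, stackHom_neg]

theorem isNonnilpotent_prod_map {f : Γ → DyckMonoid Γ}
    (hf : ∀ l : List Γ, (l.map f).prod ≠ zero Γ) (l : List Γ) :
    IsNonnilpotent (l.map f).prod := by
  intro k
  have : (l.map f).prod ^ k = ((List.replicate k l).flatten.map f).prod := by
    induction k with
    | zero => simp
    | succ k ih => rw [pow_succ', ih, List.replicate_succ]; simp
  rw [this]
  exact hf _

end DyckMonoid

/-! ### Colourings of cyclic bracket words -/

section Colorings

open DyckMonoid

variable {Γ ι : Type*}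

/-- The value in the Dyck inverse monoid of a letter: the letters are the brackets `γ(-)`
(with the flag `true`) and `γ(+)` (with the flag `false`), and neutral letters. -/
def blockValue : (Γ × Bool) ⊕ ι → DyckMonoid Γ
  | .inl (γ, true) => (MotzkinSymbol.neg γ).val
  | .inl (γ, false) => (MotzkinSymbol.pos γ).val
  | .inr _ => 1

/-- The letter without its colour. -/
def blockShape : (Γ × Bool) ⊕ ι → Bool ⊕ ι := Sum.map Prod.snd id

/-- The words of a given shape that can be repeated periodically. -/
def cyclicColorings (Γ : Type*) {ι : Type*} (s : List (Bool ⊕ ι)) : Set (List ((Γ × Bool) ⊕ ι)) :=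
  {b | b.map blockShape = s ∧ IsNonnilpotent (b.map blockValue).prod}

theorem ncard_cyclicColorings_append_comm (l r : List (Bool ⊕ ι)) :
    (cyclicColorings Γ (l ++ r)).ncard = (cyclicColorings Γ (r ++ l)).ncard := by
  rw [← Set.ncard_image_of_injective _ (List.rotate_injective l.length)]
  congr 1
  ext b
  constructor
  · rintro ⟨b, ⟨hs, hg⟩, rfl⟩
    obtain ⟨b1, b2, rfl, h1, h2⟩ := List.map_eq_append_iff.1 hs
    have hl : l.length = b1.length := by rw [← h1, List.length_map]
    simp only [hl, List.rotate_append_length_eq]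
    refine ⟨by rw [List.map_append, h1, h2], ?_⟩
    rw [List.map_append, List.prod_append] at hg ⊢
    exact hg.mul_comm
  · rintro ⟨hs, hg⟩
    obtain ⟨b1, b2, rfl, h1, h2⟩ := List.map_eq_append_iff.1 hs
    have hl : l.length = b2.length := by rw [← h2, List.length_map]
    refine ⟨b2 ++ b1, ⟨by rw [List.map_append, h1, h2], ?_⟩, ?_⟩
    · rw [List.map_append, List.prod_append] at hg ⊢
      exact hg.mul_comm
    · simp only [hl, List.rotate_append_length_eq]

theorem ncard_cyclicColorings_inr_cons (i : ι) (s : List (Bool ⊕ ι)) :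
    (cyclicColorings Γ (.inr i :: s)).ncard = (cyclicColorings Γ s).ncard := by
  rw [← Set.ncard_image_of_injective (cyclicColorings Γ s)
    (List.cons_injective (a := (Sum.inr i : (Γ × Bool) ⊕ ι)))]
  congr 1
  ext b
  constructor
  · rintro ⟨hs, hg⟩
    obtain ⟨c, b, rfl, h1, h2⟩ := List.map_eq_cons_iff.1 hs
    rcases c with ⟨γ, x⟩ | j
    · simp [blockShape] at h1
    · obtain rfl : j = i := by simpa [blockShape] using h1
      exact ⟨b, ⟨h2, by simpa [blockValue] using hg⟩, rfl⟩
  · rintro ⟨b, ⟨hs, hg⟩, rfl⟩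
    exact ⟨by simp [blockShape, ← hs], by simpa [blockValue] using hg⟩

/-- An adjacent pair cancels if its two colours agree and gives zero otherwise, so it contributes
one free colour and no further condition. -/
theorem ncard_cyclicColorings_neg_cons_pos_cons [Fintype Γ] (s : List (Bool ⊕ ι)) :
    (cyclicColorings Γ (.inl true :: .inl false :: s)).ncard =
      Fintype.card Γ * (cyclicColorings Γ s).ncard := by
  have hinj : Function.Injective (fun p : Γ × List ((Γ × Bool) ⊕ ι) =>
      Sum.inl (p.1, true) :: Sum.inl (p.1, false) :: p.2) := by
    rintro ⟨γ, b⟩ ⟨γ', b'⟩ h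
    simp only [List.cons.injEq, Sum.inl.injEq, Prod.mk.injEq, and_true] at h
    exact Prod.ext h.1 h.2.2
  rw [← Nat.card_eq_fintype_card, ← Set.ncard_univ, ← Set.ncard_prod,
    ← Set.ncard_image_of_injective _ hinj]
  congr 1
  ext b
  constructor
  · rintro ⟨hs, hg⟩
    obtain ⟨c, b, rfl, h1, h2⟩ := List.map_eq_cons_iff.1 hs
    obtain ⟨d, b, rfl, h3, h4⟩ := List.map_eq_cons_iff.1 h2
    rcases c with ⟨γ, x⟩ | j
    swap
    · simp [blockShape] at h1
    rcases d with ⟨γ', x'⟩ | j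
    swap
    · simp [blockShape] at h3
    obtain rfl : x = true := by simpa [blockShape] using h1
    obtain rfl : x' = false := by simpa [blockShape] using h3
    simp only [List.map_cons, List.prod_cons, blockValue, ← mul_assoc] at hg
    by_cases hγ : γ = γ'
    · subst hγ
      rw [neg_mul_pos, one_mul] at hg
      exact ⟨(γ, b), ⟨Set.mem_univ _, h4, hg⟩, rfl⟩
    · rw [neg_mul_pos_of_ne hγ] at hg
      exact absurd hg (not_isNonnilpotent_zero_mul _)
  · rintro ⟨⟨γ, b⟩, ⟨-, hs, hg⟩, rfl⟩
    refine ⟨by simp [blockShape, ← hs], ?_⟩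
    simp only [List.map_cons, List.prod_cons, blockValue, ← mul_assoc]
    rwa [neg_mul_pos, one_mul]

theorem ncard_map_blockShape_eq_replicate [Fintype Γ] (x : Bool) (n : ℕ) :
    {b : List ((Γ × Bool) ⊕ ι) | b.map blockShape = List.replicate n (.inl x)}.ncard =
      Fintype.card Γ ^ n := by
  have hinj : Function.Injective (fun g : Fin n → Γ =>
      List.ofFn fun i => (Sum.inl (g i, x) : (Γ × Bool) ⊕ ι)) := by
    intro g g' h
    have := List.ofFn_injective h
    funext i
    simpa using congrFun this i
  rw [← Fintype.card_fin n, ← Fintype.card_fun, Fintype.card_fin, ← Nat.card_eq_fintype_card,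
    ← Set.ncard_univ, ← Set.ncard_image_of_injective _ hinj]
  congr 1
  ext b
  constructor
  · intro hb
    have hlen : b.length = n := by simpa using congrArg List.length hb
    subst hlen
    have hget : ∀ i : Fin b.length, ∃ γ, b.get i = Sum.inl (γ, x) := by
      intro i
      have h : blockShape (b.get i) = Sum.inl x :=
        List.eq_of_mem_replicate (n := b.length) (by
          rw [← show _ = _ from hb]; exact List.mem_map_of_mem (List.get_mem b i))
      rcases hc : b.get i with ⟨γ, y⟩ | j
      · rw [hc] at h
        obtain rfl : y = x := by simpa [blockShape] using h
        exact ⟨γ, rfl⟩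
      · rw [hc] at h
        simp [blockShape] at h
    choose g hg using hget
    refine ⟨g, Set.mem_univ _, ?_⟩
    simp only [← hg]
    exact List.ofFn_get b
  · rintro ⟨g, -, rfl⟩
    rw [Set.mem_ofPred_eq, List.map_ofFn, List.eq_replicate_iff]
    simp [blockShape, List.mem_ofFn]

theorem ncard_cyclicColorings_replicate [Fintype Γ] (x : Bool) (n : ℕ) :
    (cyclicColorings Γ (List.replicate n (.inl x : Bool ⊕ ι))).ncard = Fintype.card Γ ^ n := by
  rw [← ncard_map_blockShape_eq_replicate (ι := ι) x n]
  congr 1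
  ext b
  refine ⟨fun h => h.1, fun h => ⟨h, ?_⟩⟩
  have hb : ∃ l : List Γ, b = l.map fun γ => Sum.inl (γ, x) := by
    have hmem : ∀ c ∈ b, ∃ γ, c = Sum.inl (γ, x) := by
      intro c hc
      have h' : blockShape c = Sum.inl x :=
        List.eq_of_mem_replicate (n := n) (by
          rw [← show _ = _ from h]; exact List.mem_map_of_mem hc)
      rcases c with ⟨γ, y⟩ | j
      · obtain rfl : y = x := by simpa [blockShape] using h'
        exact ⟨γ, rfl⟩
      · simp [blockShape] at h'
    clear h
    induction b with
    | nil => exact ⟨[], rfl⟩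
    | cons c b ih =>
      obtain ⟨l, rfl⟩ := ih fun c hc => hmem c (List.mem_cons_of_mem _ hc)
      obtain ⟨γ, rfl⟩ := hmem _ List.mem_cons_self
      exact ⟨γ :: l, rfl⟩
  obtain ⟨l, rfl⟩ := hb
  rw [List.map_map]
  cases x
  · exact isNonnilpotent_prod_map prod_pos_ne_zero l
  · exact isNonnilpotent_prod_map prod_neg_ne_zero l

/-- In a list of opening and closing brackets in which both occur, up to a rotation a closing
bracket follows immediately upon an opening one at the beginning. -/
theorem exists_rotation_true_false {s : List (Bool ⊕ ι)} (hi : ∀ i, Sum.inr i ∉ s)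
    (ht : Sum.inl true ∈ s) (hf : Sum.inl false ∈ s) :
    ∃ l r, s = l ++ r ∧ ∃ t, r ++ l = .inl true :: .inl false :: t := by
  suffices h : ∀ (t : List (Bool ⊕ ι)), (∀ i, Sum.inr i ∉ t) → Sum.inl false ∈ t →
      ∃ l r, Sum.inl true :: t = l ++ Sum.inl true :: Sum.inl false :: r by
    obtain ⟨l, r, rfl⟩ := List.append_of_mem ht
    obtain ⟨l', r', h'⟩ := h (r ++ l) (by
      intro i hmem
      apply hi i
      rw [List.mem_append] at hmem
      rcases hmem with hmem | hmem <;> simp [hmem]) (by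
      simp only [List.mem_append, List.mem_cons, Sum.inl.injEq, Bool.false_eq_true,
        false_or] at hf
      simpa [or_comm] using hf)
    rw [← List.cons_append] at h'
    -- The pair was found after `l` had been moved to the end; the cases locate it relative to the
    -- seam.
    rcases List.append_eq_append_iff.1 h' with ⟨a, h1, h2⟩ | ⟨a, h1, h2⟩
    · refine ⟨a, Sum.inl true :: Sum.inl false :: r' ++ Sum.inl true :: r, ?_, ?_⟩
      · rw [h2]; simp
      · exact ⟨_, rfl⟩
    · refine ⟨l ++ l', a ++ [], ?_, ?_⟩
      · rw [h1]; simp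
      · rw [List.append_nil, ← List.append_assoc, ← h2]
        exact ⟨_, rfl⟩
  intro t
  induction t with
  | nil => intro _ h; simp at h
  | cons c t ih =>
    intro hi hf
    rcases c with (_ | _) | i
    · exact ⟨[], t, rfl⟩
    · obtain ⟨l, r, h⟩ := ih (fun i h => hi i (List.mem_cons_of_mem _ h)) (by simpa using hf)
      exact ⟨.inl true :: l, r, by rw [h]; rfl⟩
    · exact absurd List.mem_cons_self (hi i)

/-- Cyclic reduction: up to rotation, a neutral letter can be dropped, and an adjacent
opening–closing pair can be removed at the price of a factor `N` while both counts drop by one. In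
the end only brackets of one kind remain, and all their colourings are allowed. -/
theorem ncard_cyclicColorings [Fintype Γ] (s : List (Bool ⊕ ι)) :
    (cyclicColorings Γ s).ncard =
      Fintype.card Γ ^ max (s.countP (Sum.elim id fun _ => false)) (s.countP (Sum.elim not fun _ => false)) := by
  induction hn : s.length using Nat.strong_induction_on generalizing s with
  | _ n ih =>
    by_cases hi : ∃ i, Sum.inr i ∈ s
    · obtain ⟨i, hi⟩ := hi
      obtain ⟨l, r, rfl⟩ := List.append_of_mem hi
      rw [ncard_cyclicColorings_append_comm, List.cons_append, ncard_cyclicColorings_inr_cons,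
        ih (r ++ l).length (by simp at hn ⊢; omega) _ rfl]
      simp [add_comm]
    push Not at hi
    by_cases ht : Sum.inl true ∈ s
    · by_cases hf : Sum.inl false ∈ s
      · obtain ⟨l, r, rfl, t, ht⟩ := exists_rotation_true_false hi ht hf
        have hlen : t.length < n := by
          have := congrArg List.length ht
          simp at this hn
          omega
        have hc : ∀ p, (l ++ r).countP p = (Sum.inl true :: Sum.inl false :: t).countP p := by
          intro p
          rw [← ht, List.countP_append, List.countP_append, add_comm]
        rw [ncard_cyclicColorings_append_comm, ht, ncard_cyclicColorings_neg_cons_pos_cons,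
          ih t.length hlen t rfl, hc, hc, ← pow_succ']
        rw [List.countP_cons_of_pos (by rfl), List.countP_cons_of_neg (by simp),
          List.countP_cons_of_neg (by simp), List.countP_cons_of_pos (by rfl),
          Nat.add_max_add_right]
      · have : s = List.replicate n (.inl true) := by
          rw [List.eq_replicate_iff]
          refine ⟨hn, fun b hb => ?_⟩
          rcases b with (_ | _) | i
          · exact absurd hb hf
          · rfl
          · exact absurd hb (hi i)
        rw [this, ncard_cyclicColorings_replicate]
        simp [List.countP_replicate]
    · have : s = List.replicate n (.inl false) := by
        rw [List.eq_replicate_iff]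
        refine ⟨hn, fun b hb => ?_⟩
        rcases b with (_ | _) | i
        · rfl
        · exact absurd hb ht
        · exact absurd hb (hi i)
      rw [this, ncard_cyclicColorings_replicate]
      simp [List.countP_replicate]

end Colorings

/-! ### Counting cyclic words through their shapes -/

section BlockWords

open PowerSeries DyckMonoid
open scoped LaurentPolynomial

variable {Γ ι : Type*}

/-- The length of the letters, where the neutral letters have length `Q`. -/
def blockLength {α : Type*} (Q : ℕ) : α ⊕ ι → ℕ := Sum.elim (fun _ => 1) (fun _ => Q)

theorem blockLength_blockShape (Q : ℕ) (c : (Γ × Bool) ⊕ ι) :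
    blockLength Q (blockShape c) = blockLength Q c := by
  rcases c with c | c <;> rfl

/-- The words of `k` letters and total length `n` that can be repeated periodically. -/
def cyclicBlockWords (Γ ι : Type*) (Q n k : ℕ) : Set (List ((Γ × Bool) ⊕ ι)) :=
  {b | b.length = k ∧ (b.map (blockLength Q)).sum = n ∧ IsNonnilpotent (b.map blockValue).prod}

theorem finite_cyclicBlockWords [Finite Γ] [Finite ι] (Q n k : ℕ) :
    (cyclicBlockWords Γ ι Q n k).Finite :=
  (List.finite_length_eq _ k).subset fun _ h => h.1

/-- The weight of a shape letter. -/
noncomputable def shapeWeight (N : ℚ) (Q : ℕ) : Bool ⊕ ι → ℚ[T;T⁻¹]⟦X⟧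
  | .inl true => C (LaurentPolynomial.T 1) * X
  | .inl false => C (LaurentPolynomial.C N * LaurentPolynomial.T (-1)) * X
  | .inr _ => X ^ Q

theorem prod_map_shapeWeight (N : ℚ) (Q : ℕ) (s : List (Bool ⊕ ι)) :
    (s.map (shapeWeight N Q)).prod =
      C (LaurentPolynomial.C (N ^ s.countP (Sum.elim not fun _ => false)) *
        LaurentPolynomial.T ((s.countP (Sum.elim id fun _ => false) : ℤ) -
          s.countP (Sum.elim not fun _ => false))) * X ^ (s.map (blockLength Q)).sum := by
  induction s with
  | nil => simp
  | cons c s ih =>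
    rw [List.map_cons, List.prod_cons, ih, List.map_cons, List.sum_cons, pow_add]
    rcases c with (_ | _) | i
    · rw [List.countP_cons_of_pos (by rfl), List.countP_cons_of_neg (by simp), Nat.cast_succ,
        ← sub_sub, sub_eq_add_neg _ (1 : ℤ), LaurentPolynomial.T_add, pow_succ]
      simp only [shapeWeight, blockLength, Sum.elim_inl, pow_one, map_mul]
      ring
    · rw [List.countP_cons_of_neg (by simp), List.countP_cons_of_pos (by rfl), Nat.cast_succ,
        add_sub_right_comm, LaurentPolynomial.T_add]
      simp only [shapeWeight, blockLength, Sum.elim_inl, pow_one, map_mul]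
      ring
    · rw [List.countP_cons_of_neg (by simp), List.countP_cons_of_neg (by simp)]
      simp only [shapeWeight, blockLength, Sum.elim_inr, map_mul]
      ring

/-- For `a` opening and `b` closing brackets the weight is `N ^ b * T ^ (a - b)`, and `b + max (a -
b) 0 = max a b`. -/
theorem laurentMaxEval_coeff_prod_map_shapeWeight (N : ℚ) (Q n : ℕ) (s : List (Bool ⊕ ι)) :
    laurentMaxEval N (coeff n (s.map (shapeWeight N Q)).prod) =
      if (s.map (blockLength Q)).sum = n then
        N ^ max (s.countP (Sum.elim id fun _ => false)) (s.countP (Sum.elim not fun _ => false))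
      else 0 := by
  rw [prod_map_shapeWeight, coeff_C_mul, coeff_X_pow]
  split_ifs with h1 h2 h2
  · rw [mul_one, laurentMaxEval_C_mul_T, ← pow_add]
    congr 1
    omega
  · exact absurd h1.symm h2
  · exact absurd h2.symm h1
  · simp

/-- Expanding the `k`-th power gives one product of weights for each shape of `k` letters. The words
are counted in the fibres over their shapes. -/
theorem ncard_cyclicBlockWords [Fintype Γ] [Fintype ι] (Q n k : ℕ) :
    ((cyclicBlockWords Γ ι Q n k).ncard : ℚ) =
      laurentMaxEval (Fintype.card Γ) (coeff n
        ((C (LaurentPolynomial.T 1) * X +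
          C (LaurentPolynomial.C (Fintype.card Γ : ℚ) * LaurentPolynomial.T (-1)) * X +
          C (LaurentPolynomial.C (Fintype.card ι : ℚ)) * X ^ Q) ^ k)) := by
  classical
  set N : ℚ := (Fintype.card Γ : ℚ)
  have hF : C (LaurentPolynomial.T 1) * X +
      C (LaurentPolynomial.C N * LaurentPolynomial.T (-1)) * X +
      C (LaurentPolynomial.C (Fintype.card ι : ℚ)) * X ^ Q =
      ∑ σ : Bool ⊕ ι, shapeWeight N Q σ := by
    rw [Fintype.sum_sum_type, Fintype.sum_bool]
    simp [shapeWeight]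
  have hprod : ∀ s : Fin k → Bool ⊕ ι, ∏ i, shapeWeight N Q (s i) =
      ((List.ofFn s).map (shapeWeight N Q)).prod := fun s => by
    rw [List.map_ofFn, List.prod_ofFn]; rfl
  rw [hF, Fintype.sum_pow, map_sum, map_sum]
  simp only [hprod, laurentMaxEval_coeff_prod_map_shapeWeight]
  have hfin := finite_cyclicBlockWords (Γ := Γ) (ι := ι) Q n k
  rw [Set.ncard_eq_toFinset_card _ hfin,
    Finset.card_eq_sum_card_fiberwise (f := List.map blockShape)
      (t := Finset.univ.image fun s : Fin k → Bool ⊕ ι => List.ofFn s)]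
  · rw [Finset.sum_image fun s _ s' _ h => List.ofFn_injective h, Nat.cast_sum]
    refine Finset.sum_congr rfl fun s _ => ?_
    have hmem : ∀ b : List ((Γ × Bool) ⊕ ι), b.map blockShape = List.ofFn s →
        b.length = k ∧ b.map (blockLength Q) = (List.ofFn s).map (blockLength Q) := by
      intro b hb
      refine ⟨by simpa using congrArg List.length hb, ?_⟩
      rw [← hb, List.map_map]
      exact List.map_congr_left fun c _ => (blockLength_blockShape Q c).symm
    split_ifs with h
    · have hN := ncard_cyclicColorings (Γ := Γ) (List.ofFn s)
      rw [← Nat.cast_pow, ← hN, ← Set.ncard_coe_finset]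
      congr 2
      ext b
      simp only [Finset.coe_filter, Set.Finite.mem_toFinset, Set.mem_ofPred_eq, cyclicBlockWords,
        cyclicColorings]
      constructor
      · rintro ⟨⟨-, -, hg⟩, hb⟩
        exact ⟨hb, hg⟩
      · rintro ⟨hb, hg⟩
        exact ⟨⟨(hmem b hb).1, by rw [(hmem b hb).2, h], hg⟩, hb⟩
    · rw [Nat.cast_eq_zero, Finset.card_eq_zero, Finset.filter_eq_empty_iff]
      intro b hb hbs
      rw [Set.Finite.mem_toFinset] at hb
      exact h (by rw [← (hmem b hbs).2]; exact hb.2.1)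
  · intro b hb
    have hb' := (Set.Finite.mem_toFinset _).1 (Finset.mem_coe.1 hb)
    rw [Finset.mem_coe, Finset.mem_image]
    have hlen : (b.map (blockShape (Γ := Γ) (ι := ι))).length = k := by
      rw [List.length_map]; exact hb'.1
    subst hlen
    exact ⟨(b.map blockShape).get, Finset.mem_univ _, List.ofFn_get _⟩

end BlockWords

/-! ### Words of bi-infinite sequences and a double count of marked positions -/

section Words

variable {A : Type*}

/-- The word of length `m` of the sequence `x` that begins at the position `i`. -/
def wordOf (x : ℤ → A) (i : ℤ) (m : ℕ) : List A := List.ofFn fun k : Fin m => x (i + (k : ℕ))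

theorem length_wordOf (x : ℤ → A) (i : ℤ) (m : ℕ) : (wordOf x i m).length = m := by
  simp [wordOf]

theorem getElem_wordOf (x : ℤ → A) (i : ℤ) (m k : ℕ) (hk : k < (wordOf x i m).length) :
    (wordOf x i m)[k] = x (i + k) := by
  simp [wordOf]

theorem wordOf_zero (x : ℤ → A) (i : ℤ) : wordOf x i 0 = [] := by
  simp [wordOf]

theorem wordOf_succ (x : ℤ → A) (i : ℤ) (m : ℕ) :
    wordOf x i (m + 1) = x i :: wordOf x (i + 1) m := by
  rw [wordOf, List.ofFn_succ, wordOf]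
  simp only [Fin.val_zero, Fin.val_succ, Nat.cast_zero, add_zero, Nat.cast_succ]
  congr 2
  funext k
  congr 1
  ring

theorem wordOf_add (x : ℤ → A) (i : ℤ) (m m' : ℕ) :
    wordOf x i (m + m') = wordOf x i m ++ wordOf x (i + m) m' := by
  rw [wordOf, List.ofFn_add]
  simp only [Fin.val_castLE, Fin.val_natAdd, Nat.cast_add, ← add_assoc]
  rfl

theorem wordOf_congr {x y : ℤ → A} {i j : ℤ} {m : ℕ} (h : ∀ k : ℕ, x (i + k) = y (j + k)) :
    wordOf x i m = wordOf y j m := by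
  simp [wordOf, h]

variable {n : ℕ} {x : ℤ → A}

theorem periodic_add_mul (h : ∀ i, x (i + n) = x i) (k i : ℤ) : x (i + n * k) = x i := by
  have hp : Function.Periodic x (n : ℤ) := h
  have := hp.int_mul k i
  rwa [mul_comm] at this

theorem prod_map_wordOf_mul {M : Type*} [Monoid M] (f : A → M) (h : ∀ i, x (i + n) = x i) (i : ℤ)
    (k : ℕ) : ((wordOf x i (n * k)).map f).prod = ((wordOf x i n).map f).prod ^ k := by
  induction k with
  | zero => simp [wordOf_zero]
  | succ k ih =>
    rw [Nat.mul_succ, wordOf_add, List.map_append, List.prod_append, ih, pow_succ]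
    congr 3
    apply wordOf_congr
    intro l
    have := periodic_add_mul h k (i + l)
    rw [← this]
    congr 1
    push_cast
    ring

theorem eq_of_wordOf_eq (hn : 0 < n) {y : ℤ → A} (hx : ∀ i, x (i + n) = x i)
    (hy : ∀ i, y (i + n) = y i) (h : wordOf x 0 n = wordOf y 0 n) : x = y := by
  have hf := List.ofFn_injective h
  funext i
  have hn' : (n : ℤ) ≠ 0 := by omega
  have h0 := Int.emod_nonneg i hn'
  have h1 := Int.emod_lt_of_pos i (by omega : (0 : ℤ) < n)
  have hk := congrFun hf ⟨(i % n).toNat, by omega⟩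
  simp only [Int.toNat_of_nonneg h0, zero_add] at hk
  rw [← Int.emod_add_mul_ediv i n, periodic_add_mul hx, periodic_add_mul hy, hk]

/-- The periodic sequence with the period word `w`. -/
def periodicExtension (w : List A) (hw : 0 < w.length) (i : ℤ) : A :=
  w[(i % w.length).toNat]'(by
    have h0 := Int.emod_nonneg i (by omega : (w.length : ℤ) ≠ 0)
    have h1 := Int.emod_lt_of_pos i (by omega : (0 : ℤ) < w.length)
    omega)

theorem periodicExtension_add (w : List A) (hw : 0 < w.length) (i : ℤ) :
    periodicExtension w hw (i + w.length) = periodicExtension w hw i := by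
  simp [periodicExtension]

theorem wordOf_periodicExtension (w : List A) (hw : 0 < w.length) :
    wordOf (periodicExtension w hw) 0 w.length = w := by
  apply List.ext_getElem
  · rw [length_wordOf]
  · intro k h1 h2
    rw [getElem_wordOf, zero_add, periodicExtension]
    congr 1
    rw [← Int.natCast_emod, Int.toNat_natCast, Nat.mod_eq_of_lt h2]

variable (p : A → Prop) [DecidablePred p]

theorem countP_wordOf_eq_sum (x : ℤ → A) (n : ℕ) :
    (wordOf x 0 n).countP p = ∑ i ∈ Finset.range n, if p (x i) then 1 else 0 := by
  induction n with
  | zero => simp [wordOf_zero]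
  | succ n ih =>
    rw [wordOf_add, List.countP_append, ih, Finset.sum_range_succ, zero_add, wordOf_succ,
      wordOf_zero]
    simp [List.countP_cons]

theorem shiftMap_iterate (x : ℤ → A) (i : ℕ) (j : ℤ) : shiftMap^[i] x j = x (j + i) := by
  induction i generalizing x with
  | zero => simp
  | succ i ih =>
    rw [Function.iterate_succ_apply, ih, shiftMap]
    congr 1
    push_cast
    ring

/-- The shift drops `x 0` in front and appends `x n = x 0` at the end. -/
theorem countP_wordOf_shiftMap (h : ∀ i, x (i + n) = x i) :
    (wordOf (shiftMap x) 0 n).countP p = (wordOf x 0 n).countP p := by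
  have h1 : wordOf (shiftMap x) 0 n = wordOf x 1 n := by
    apply wordOf_congr
    intro k
    rw [shiftMap]
    congr 1
    ring
  have h2 : x 0 :: wordOf x 1 n = wordOf x 0 n ++ [x 0] := by
    have h3 := wordOf_succ x 0 n
    rw [wordOf_add, wordOf_succ, wordOf_zero, h 0] at h3
    exact h3.symm
  have h4 := congrArg (List.countP p) h2
  rw [List.countP_append, List.countP_cons, List.countP_cons] at h4
  rw [h1]
  simpa using h4

/-- Every point of a shift invariant set of `n`-periodic sequences has `n` shifts, of which as many
are marked at the origin as there are marked positions in a period. -/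
theorem card_eq_mul_sum_inv_countP (W : Finset (ℤ → A)) (hn : 0 < n)
    (hper : ∀ x ∈ W, ∀ i, x (i + n) = x i) (hshift : ∀ x ∈ W, shiftMap x ∈ W)
    (hpos : ∀ x ∈ W, ∃ i, p (x i)) :
    (W.card : ℚ) = n * ∑ y ∈ W with p (y 0), (((wordOf y 0 n).countP p : ℕ) : ℚ)⁻¹ := by
  set c : (ℤ → A) → ℚ := fun y => (((wordOf y 0 n).countP p : ℕ) : ℚ) with hc
  have hcne : ∀ x ∈ W, c x ≠ 0 := by
    intro x hx
    obtain ⟨i, hi⟩ := hpos x hx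
    have hn' : (n : ℤ) ≠ 0 := by omega
    have h0 := Int.emod_nonneg i hn'
    have h1 := Int.emod_lt_of_pos i (by omega : (0 : ℤ) < n)
    rw [← Int.emod_add_mul_ediv i n, periodic_add_mul (hper x hx)] at hi
    rw [hc, Nat.cast_ne_zero, ← Nat.pos_iff_ne_zero, List.countP_pos_iff]
    refine ⟨x (i % n), ?_, by simpa using hi⟩
    rw [wordOf, List.mem_ofFn]
    exact ⟨⟨(i % n).toNat, by omega⟩, by simp [Int.toNat_of_nonneg h0]⟩
  have hiter : ∀ (i : ℕ), ∀ x ∈ W, shiftMap^[i] x ∈ W ∧ c (shiftMap^[i] x) = c x := by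
    intro i
    induction i with
    | zero => intro x hx; exact ⟨hx, rfl⟩
    | succ i ih =>
      intro x hx
      rw [Function.iterate_succ_apply']
      obtain ⟨h1, h2⟩ := ih x hx
      refine ⟨hshift _ h1, ?_⟩
      rw [← h2, hc]
      simp only [countP_wordOf_shiftMap p (hper _ h1)]
  have hinj : ∀ i : ℕ, Function.Injective (shiftMap^[i] : (ℤ → A) → ℤ → A) := by
    intro i x y h
    funext j
    have := congrFun h (j - i)
    simpa [shiftMap_iterate] using this
  -- An injective self-map of the finite set `W` is a permutation.
  have hre : ∀ (i : ℕ) (g : (ℤ → A) → ℚ), ∑ x ∈ W, g (shiftMap^[i] x) = ∑ x ∈ W, g x := by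
    intro i g
    have hmaps : Set.MapsTo (shiftMap^[i]) (W : Set (ℤ → A)) W := fun x hx => (hiter i x hx).1
    exact Finset.sum_nbij (shiftMap^[i]) (fun x hx => (hiter i x hx).1) (hinj i).injOn
      (Finset.surjOn_of_injOn_of_card_le _ hmaps (hinj i).injOn le_rfl) fun _ _ => rfl
  -- Each point distributes its weight 1 equally over the `c x` marked positions of a period;
  -- shifting then moves every marked position to the origin.
  calc (W.card : ℚ) = ∑ x ∈ W, ∑ i ∈ Finset.range n, (if p (x i) then (c x)⁻¹ else 0) := by
        rw [Finset.card_eq_sum_ones, Nat.cast_sum]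
        refine Finset.sum_congr rfl fun x hx => ?_
        have h1 : c x = ∑ i ∈ Finset.range n, if p (x i) then (1 : ℚ) else 0 := by
          rw [hc]
          simp only [countP_wordOf_eq_sum]
          push_cast
          rfl
        calc ((1 : ℕ) : ℚ) = c x * (c x)⁻¹ := by rw [mul_inv_cancel₀ (hcne x hx), Nat.cast_one]
          _ = (∑ i ∈ Finset.range n, if p (x i) then (1 : ℚ) else 0) * (c x)⁻¹ := by rw [← h1]
          _ = _ := by
            rw [Finset.sum_mul]
            refine Finset.sum_congr rfl fun i _ => ?_
            split_ifs <;> simp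
    _ = ∑ i ∈ Finset.range n, ∑ x ∈ W, (if p (x i) then (c x)⁻¹ else 0) := Finset.sum_comm
    _ = ∑ i ∈ Finset.range n, ∑ x ∈ W, (if p (x 0) then (c x)⁻¹ else 0) := by
        refine Finset.sum_congr rfl fun i _ => ?_
        rw [← hre i fun x => if p (x 0) then (c x)⁻¹ else 0]
        refine Finset.sum_congr rfl fun x hx => ?_
        rw [(hiter i x hx).2, shiftMap_iterate, zero_add]
    _ = n * ∑ y ∈ W with p (y 0), (c y)⁻¹ := by
        rw [Finset.sum_const, Finset.card_range, nsmul_eq_mul, Finset.sum_filter]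

end Words

/-! ### Closed walks in the bouquet with loops -/

namespace LabeledGraph

variable {V E A : Type*} (G : LabeledGraph V E A)

/-- The list of edges is a path from `v` to `w`. -/
def IsWalk : V → List E → V → Prop
  | v, [], w => v = w
  | v, e :: p, w => G.src e = v ∧ IsWalk (G.tgt e) p w

theorem IsWalk.append {u v w : V} {p q : List E} (hp : G.IsWalk u p v) (hq : G.IsWalk v q w) :
    G.IsWalk u (p ++ q) w := by
  induction p generalizing u with
  | nil =>
    obtain rfl : u = v := hp
    exact hq
  | cons e p ih => exact ⟨hp.1, ih hp.2⟩

theorem isWalk_wordOf {x : ℤ → E} (h : ∀ i, G.tgt (x i) = G.src (x (i + 1))) (i : ℤ) (m : ℕ) :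
    G.IsWalk (G.src (x i)) (wordOf x i m) (G.src (x (i + m))) := by
  induction m generalizing i with
  | zero => simp [wordOf_zero, IsWalk]
  | succ m ih =>
    rw [wordOf_succ]
    refine ⟨rfl, ?_⟩
    rw [h]
    convert ih (i + 1) using 3
    push_cast
    ring

theorem IsWalk.src_getElem_zero {v w : V} {p : List E} (h : G.IsWalk v p w) (hp : 0 < p.length) :
    G.src p[0] = v := by
  cases p with
  | nil => simp at hp
  | cons e p => exact h.1

theorem IsWalk.tgt_getElem {v w : V} {p : List E} (h : G.IsWalk v p w) {i : ℕ}
    (hi : i < p.length) :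
    G.tgt p[i] = if hi' : i + 1 < p.length then G.src p[i + 1] else w := by
  induction p generalizing v i with
  | nil => simp at hi
  | cons e p ih =>
    cases i with
    | zero =>
      cases p with
      | nil => exact h.2
      | cons e' p => exact h.2.1.symm
    | succ i =>
      have := ih h.2 (i := i) (by simpa using hi)
      simpa using this

/-- The only new junction is from the last edge to the first, and it fits because the walk returns
to `v`. -/
theorem IsWalk.tgt_periodicExtension {v : V} {p : List E} (h : G.IsWalk v p v)
    (hp : 0 < p.length) (i : ℤ) :
    G.tgt (periodicExtension p hp i) = G.src (periodicExtension p hp (i + 1)) := by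
  have hn : (p.length : ℤ) ≠ 0 := by omega
  have h0 := Int.emod_nonneg i hn
  have h1 := Int.emod_lt_of_pos i (by omega : (0 : ℤ) < p.length)
  have hmod : (i + 1) % (p.length : ℤ) = (i % p.length + 1) % p.length := by simp
  rw [periodicExtension, periodicExtension, h.tgt_getElem]
  split_ifs with hi
  · congr 2
    have key : ∀ r : ℤ, 0 ≤ r → r < p.length → r.toNat + 1 < p.length →
        r.toNat + 1 = ((r + 1) % p.length).toNat := by
      intro r h0 h1 hi
      rw [Int.emod_eq_of_lt (by omega) (by omega)]
      omega
    rw [hmod, key _ h0 h1 hi]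
  · have : (i + 1) % (p.length : ℤ) = 0 := by
      rw [hmod, show i % (p.length : ℤ) + 1 = p.length by omega, Int.emod_self]
    simp only [this, Int.toNat_zero]
    exact (h.src_getElem_zero G hp).symm

end LabeledGraph

/-! ### First-return decomposition of closed walks at the base vertex -/

section Bouquet

open DyckMonoid

variable {Γ : Type*} {J Q : ℕ}

/-- The edges of the bouquet with loops. -/
abbrev BouquetEdge (Γ : Type*) (J Q : ℕ) :=
  (Fin J × Fin Q) ⊕ DyckLoop (fun _ : Γ => 1) (fun _ : Γ => 1)

/-- The bouquet with a loop `γ(-)` and a loop `γ(+)` for every `γ`. -/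
abbrev loopBouquet (Γ : Type*) (J Q : ℕ) :
    LabeledGraph (BouquetVertex J Q) (BouquetEdge Γ J Q) (BouquetEdge Γ J Q) :=
  (bouquet J Q).attachLoops BouquetVertex.base (fun _ => 1) (fun _ => 1)

theorem loopBouquet_label (e : BouquetEdge Γ J Q) : (loopBouquet Γ J Q).label e = e := by
  rcases e with e | e <;> rfl

/-- The value of an edge in the Dyck inverse monoid. -/
def edgeValue (e : BouquetEdge Γ J Q) : DyckMonoid Γ := (loopSymbol e).val

theorem bouquetPoint_zero (j : Fin J) : (bouquetPoint j 0 : BouquetVertex J Q) = .base := by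
  simp [bouquetPoint]

theorem bouquetPoint_self (j : Fin J) : (bouquetPoint j Q : BouquetVertex J Q) = .base := by
  simp [bouquetPoint]

theorem bouquetPoint_of_lt (j : Fin J) {q : ℕ} (h : 1 ≤ q ∧ q < Q) :
    (bouquetPoint j q : BouquetVertex J Q) = .inner j q h := by
  simp [bouquetPoint, h]

/-- The edges of a circle from the point number `q` to its end. -/
def circleArc (Γ : Type*) (j : Fin J) (q : ℕ) : List (BouquetEdge Γ J Q) :=
  (List.ofFn fun i : Fin Q => Sum.inl (j, i)).drop q

theorem circleArc_eq_cons (j : Fin J) {q : ℕ} (hq : q < Q) :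
    circleArc Γ j q = Sum.inl (j, ⟨q, hq⟩) :: circleArc Γ j (q + 1) := by
  rw [circleArc, List.drop_eq_getElem_cons (by simpa using hq)]
  simp [circleArc]

theorem circleArc_self (j : Fin J) : (circleArc Γ j Q : List (BouquetEdge Γ J Q)) = [] := by
  simp [circleArc]

theorem isWalk_circleArc (j : Fin J) {q : ℕ} (hq : q ≤ Q) :
    (loopBouquet Γ J Q).IsWalk (bouquetPoint j q) (circleArc Γ j q) .base := by
  induction hq using Nat.decreasingInduction with
  | self => rw [circleArc_self]; exact bouquetPoint_self j
  | of_succ q hq ih => rw [circleArc_eq_cons j hq]; exact ⟨rfl, ih⟩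

/-- A walk that has entered a circle follows it to its end. -/
theorem exists_eq_circleArc_append (j : Fin J) {q : ℕ} (hq : q ≤ Q) (h1 : 1 ≤ q)
    {p : List (BouquetEdge Γ J Q)}
    (hp : (loopBouquet Γ J Q).IsWalk (bouquetPoint j q) p .base) :
    ∃ r, p = circleArc Γ j q ++ r ∧ (loopBouquet Γ J Q).IsWalk .base r .base := by
  induction hq using Nat.decreasingInduction generalizing p with
  | self =>
    rw [bouquetPoint_self] at hp
    exact ⟨p, by rw [circleArc_self, List.nil_append], hp⟩
  | of_succ q hq ih =>
    rw [bouquetPoint_of_lt j ⟨h1, hq⟩] at hp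
    cases p with
    | nil => cases hp
    | cons e p =>
      obtain ⟨he, hp⟩ := hp
      have he' : e = Sum.inl (j, ⟨q, hq⟩) := by
        rcases e with ⟨j', q'⟩ | e
        · change bouquetPoint j' q' = _ at he
          rw [bouquetPoint] at he
          split_ifs at he with h
          cases he
          rfl
        · cases he
      subst he'
      obtain ⟨r, rfl, hr⟩ := ih (by omega) hp
      exact ⟨r, by rw [circleArc_eq_cons j hq, List.cons_append], hr⟩

/-- The closed walk at the base vertex that corresponds to a letter. -/
def blockEdges : (Γ × Bool) ⊕ Fin J → List (BouquetEdge Γ J Q)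
  | .inl (γ, true) => [Sum.inr (DyckLoop.neg γ 0)]
  | .inl (γ, false) => [Sum.inr (DyckLoop.pos γ 0)]
  | .inr j => circleArc Γ j 0

theorem isWalk_flatMap_blockEdges (b : List ((Γ × Bool) ⊕ Fin J)) :
    (loopBouquet Γ J Q).IsWalk .base (b.flatMap blockEdges) .base := by
  induction b with
  | nil => rfl
  | cons c b ih =>
    rw [List.flatMap_cons]
    refine LabeledGraph.IsWalk.append _ ?_ ih
    rcases c with ⟨γ, _ | _⟩ | j
    · exact ⟨rfl, rfl⟩
    · exact ⟨rfl, rfl⟩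
    · have := isWalk_circleArc (Γ := Γ) j (Nat.zero_le Q)
      rwa [bouquetPoint_zero] at this

/-- The first edge from the base is a loop or the first edge of a circle. In the latter case the
walk must complete the circle, so one letter can be split off. -/
theorem exists_flatMap_blockEdges_eq {p : List (BouquetEdge Γ J Q)}
    (hp : (loopBouquet Γ J Q).IsWalk .base p .base) :
    ∃ b : List ((Γ × Bool) ⊕ Fin J), b.flatMap blockEdges = p := by
  induction hn : p.length using Nat.strong_induction_on generalizing p with
  | _ n ih =>
    cases p with
    | nil => exact ⟨[], rfl⟩
    | cons e p =>
      obtain ⟨he, hp⟩ := hp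
      rw [List.length_cons] at hn
      rcases e with ⟨j, q, hq⟩ | e
      · obtain rfl : q = 0 := by
          by_contra h0
          change bouquetPoint j q = _ at he
          rw [bouquetPoint_of_lt j ⟨by omega, hq⟩] at he
          cases he
        obtain ⟨r, rfl, hr⟩ := exists_eq_circleArc_append (Γ := Γ) j (q := 1) hq le_rfl hp
        rw [List.length_append] at hn
        obtain ⟨b, rfl⟩ := ih r.length (by omega) hr rfl
        exact ⟨.inr j :: b, by
          rw [List.flatMap_cons, blockEdges, circleArc_eq_cons j hq, List.cons_append]⟩
      · obtain ⟨b, rfl⟩ := ih p.length (by omega) hp rfl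
        rcases e with ⟨γ, k⟩ | ⟨γ, k⟩
        · obtain rfl : k = 0 := Subsingleton.elim _ _
          exact ⟨.inl (γ, true) :: b, rfl⟩
        · obtain rfl : k = 0 := Subsingleton.elim _ _
          exact ⟨.inl (γ, false) :: b, rfl⟩

/-- The first edge already determines the letter; `1 ≤ Q` ensures that a circle has a first edge.
Hence the decomposition into letters is unique. -/
theorem blockEdges_injective_of_append (hQ : 1 ≤ Q) {c c' : (Γ × Bool) ⊕ Fin J}
    {p p' : List (BouquetEdge Γ J Q)} (h : blockEdges c ++ p = blockEdges c' ++ p') : c = c' := by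
  have hh := congrArg List.head? h
  rcases c with ⟨γ, _ | _⟩ | j <;> rcases c' with ⟨γ', _ | _⟩ | j' <;>
    simp_all [blockEdges, circleArc_eq_cons (Γ := Γ) _ (show 0 < Q by omega)]

theorem flatMap_blockEdges_injective (hQ : 1 ≤ Q) :
    Function.Injective fun b : List ((Γ × Bool) ⊕ Fin J) =>
      (b.flatMap blockEdges : List (BouquetEdge Γ J Q)) := by
  have hne : ∀ c : (Γ × Bool) ⊕ Fin J, (blockEdges c : List (BouquetEdge Γ J Q)) ≠ [] := by
    rintro (⟨γ, _ | _⟩ | j)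
    · simp [blockEdges]
    · simp [blockEdges]
    · simp [blockEdges, circleArc_eq_cons (Γ := Γ) j (show 0 < Q by omega)]
  intro b b' h
  induction b generalizing b' with
  | nil =>
    cases b' with
    | nil => rfl
    | cons c b' =>
      simp only [List.flatMap_nil, List.flatMap_cons] at h
      exact absurd (List.append_eq_nil_iff.1 h.symm).1 (hne c)
  | cons c b ih =>
    cases b' with
    | nil =>
      simp only [List.flatMap_nil, List.flatMap_cons] at h
      exact absurd (List.append_eq_nil_iff.1 h).1 (hne c)
    | cons c' b' =>
      simp only [List.flatMap_cons] at h
      obtain rfl := blockEdges_injective_of_append hQ h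
      rw [ih (List.append_cancel_left h)]

theorem length_flatMap_blockEdges (b : List ((Γ × Bool) ⊕ Fin J)) :
    (b.flatMap blockEdges : List (BouquetEdge Γ J Q)).length = (b.map (blockLength Q)).sum := by
  rw [List.length_flatMap]
  congr 1
  refine List.map_congr_left fun c _ => ?_
  rcases c with ⟨γ, _ | _⟩ | j
  · rfl
  · rfl
  · simp [blockEdges, circleArc, blockLength]

theorem prod_map_edgeValue_flatMap (b : List ((Γ × Bool) ⊕ Fin J)) :
    ((b.flatMap blockEdges : List (BouquetEdge Γ J Q)).map edgeValue).prod =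
      (b.map blockValue).prod := by
  induction b with
  | nil => rfl
  | cons c b ih =>
    rw [List.flatMap_cons, List.map_append, List.prod_append, ih, List.map_cons, List.prod_cons]
    congr 1
    rcases c with ⟨γ, _ | _⟩ | j
    · simp [blockEdges, edgeValue, loopSymbol, blockValue]
    · simp [blockEdges, edgeValue, loopSymbol, blockValue]
    · apply List.prod_eq_one
      intro m hm
      simp only [blockEdges, circleArc, List.drop_zero, List.mem_map, List.mem_ofFn] at hm
      obtain ⟨_, ⟨i, rfl⟩, rfl⟩ := hm
      rfl

-- Only the first edge of a letter starts at the base, so the visits to the base count the letters.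
open Classical in
theorem countP_flatMap_blockEdges (hQ : 1 ≤ Q) (b : List ((Γ × Bool) ⊕ Fin J)) :
    (b.flatMap blockEdges).countP (fun e => (loopBouquet Γ J Q).src e = .base) = b.length := by
  have harc : ∀ (j : Fin J) {q : ℕ} (hq : q ≤ Q), 1 ≤ q →
      (circleArc Γ j q).countP (fun e => (loopBouquet Γ J Q).src e = .base) = 0 := by
    intro j q hq
    induction hq using Nat.decreasingInduction with
    | self => intro _; rw [circleArc_self]; rfl
    | of_succ q hq ih =>
      intro h1
      rw [circleArc_eq_cons j hq, List.countP_cons_of_neg, ih (by omega)]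
      intro h
      have h' : bouquetPoint j q = _ := of_decide_eq_true h
      rw [bouquetPoint_of_lt j ⟨h1, hq⟩] at h'
      cases h'
  induction b with
  | nil => rfl
  | cons c b ih =>
    rw [List.flatMap_cons, List.countP_append, ih, List.length_cons, add_comm]
    congr 1
    rcases c with ⟨γ, _ | _⟩ | j
    · rw [blockEdges, List.countP_cons_of_pos (by simp [LabeledGraph.attachLoops])]; rfl
    · rw [blockEdges, List.countP_cons_of_pos (by simp [LabeledGraph.attachLoops])]; rfl
    · rw [blockEdges, circleArc_eq_cons j (show 0 < Q by omega), List.countP_cons_of_pos,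
        harc j (show 0 + 1 ≤ Q by omega) (by omega)]
      exact decide_eq_true (bouquetPoint_zero j)

end Bouquet

/-! ### Periodic points and the zeta function of the bouquet shift -/

section BouquetZeta

open DyckMonoid

variable {Γ : Type*} {J Q : ℕ}

theorem mem_bouquetShift_iff {x : ℤ → BouquetEdge Γ J Q} :
    x ∈ bouquetShift Γ J Q ↔ ∀ (i : ℤ) (m : ℕ), (loopBouquet Γ J Q).IsPath (wordOf x i m) ∧
      ((wordOf x i m).map edgeValue).prod ≠ DyckMonoid.zero Γ := by
  have hval : ∀ p : List (BouquetEdge Γ J Q),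
      (p.map fun e => loopSymbol ((loopBouquet Γ J Q).label e)).map MotzkinSymbol.val =
        p.map edgeValue := by
    intro p
    rw [List.map_map]
    refine List.map_congr_left fun e _ => ?_
    rw [Function.comp_apply, loopBouquet_label, edgeValue]
  have hlab : ∀ p : List (BouquetEdge Γ J Q), p.map (loopBouquet Γ J Q).label = p := by
    intro p
    rw [List.map_congr_left (g := id) fun e _ => loopBouquet_label e, List.map_id]
  refine forall_congr' fun i => forall_congr' fun m => ?_
  constructor
  · rintro ⟨p, ⟨h1, h2⟩, h3⟩
    rw [hlab] at h3
    have h3' : wordOf x i m = p := h3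
    rw [IsMotzkinAdmissible, hval] at h2
    rw [h3']
    exact ⟨h1, h2⟩
  · rintro ⟨h1, h2⟩
    refine ⟨wordOf x i m, ⟨h1, ?_⟩, (hlab _).symm⟩
    rw [IsMotzkinAdmissible, hval]
    exact h2

theorem forall_isPath_wordOf_iff {V E A : Type*} {G : LabeledGraph V E A} {x : ℤ → E} :
    (∀ i m, G.IsPath (wordOf x i m)) ↔ ∀ i, G.tgt (x i) = G.src (x (i + 1)) := by
  constructor
  · intro h i
    have := List.isChain_iff_getElem.1 (h i 2) 0 (by simp [length_wordOf])
    simpa [getElem_wordOf] using this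
  · intro h i m
    refine List.isChain_iff_getElem.2 fun k hk => ?_
    rw [getElem_wordOf, getElem_wordOf, h]
    congr 2
    push_cast
    ring

/-- Powers of the period word are words of `x`, and conversely every word of `x` is a factor of such
a power, which would vanish with the factor. -/
theorem mem_periodicPoints_bouquetShift_iff {n : ℕ} (hn : 0 < n) {x : ℤ → BouquetEdge Γ J Q} :
    x ∈ periodicPoints (bouquetShift Γ J Q) n ↔ (∀ i, x (i + n) = x i) ∧
      (∀ i, (loopBouquet Γ J Q).tgt (x i) = (loopBouquet Γ J Q).src (x (i + 1))) ∧
      IsNonnilpotent ((wordOf x 0 n).map edgeValue).prod := by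
  have hper : Function.IsPeriodicPt shiftMap n x ↔ ∀ i, x (i + n) = x i := by
    rw [Function.IsPeriodicPt, Function.IsFixedPt, funext_iff]
    simp only [shiftMap_iterate]
  change x ∈ bouquetShift Γ J Q ∧ Function.IsPeriodicPt shiftMap n x ↔ _
  rw [hper, and_comm, mem_bouquetShift_iff]
  refine and_congr_right fun hx => ?_
  rw [← forall_isPath_wordOf_iff]
  constructor
  · intro h
    refine ⟨fun i m => (h i m).1, fun k => ?_⟩
    rw [← prod_map_wordOf_mul edgeValue hx]
    exact (h 0 _).2
  · rintro ⟨h1, h2⟩ i m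
    refine ⟨h1 i m, fun h0 => ?_⟩
    have hn' : (n : ℤ) ≠ 0 := by omega
    have hr0 := Int.emod_nonneg i hn'
    obtain ⟨r, hr⟩ := Int.eq_ofNat_of_zero_le hr0
    have hir : i = r + n * (i / n) := by
      rw [← hr]
      exact (Int.emod_add_mul_ediv i n).symm
    have hw : wordOf x i m = wordOf x r m := by
      apply wordOf_congr
      intro k
      rw [← periodic_add_mul hx (i / n) (r + k)]
      congr 1
      linarith
    -- The word, moved to the residue `r`, ends at position `r + m`, so `r + m` periods from 0
    -- contain it.
    have hle : r + m ≤ n * (r + m) := Nat.le_mul_of_pos_left _ hn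
    obtain ⟨d, hd⟩ := Nat.exists_eq_add_of_le hle
    apply h2 (r + m)
    rw [← prod_map_wordOf_mul edgeValue hx, hd, wordOf_add, wordOf_add, zero_add, ← hw]
    simp only [List.map_append, List.prod_append, h0, DyckMonoid.mul_zero, DyckMonoid.zero_mul]

theorem shiftMap_mem_periodicPoints {n : ℕ} {x : ℤ → BouquetEdge Γ J Q}
    (hx : x ∈ periodicPoints (bouquetShift Γ J Q) n) :
    shiftMap x ∈ periodicPoints (bouquetShift Γ J Q) n := by
  obtain ⟨h1, h2⟩ := hx
  refine ⟨mem_bouquetShift_iff.2 fun i m => ?_, ?_⟩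
  · have hw : wordOf (shiftMap x) i m = wordOf x (i + 1) m := by
      apply wordOf_congr
      intro k
      rw [shiftMap]
      congr 1
      ring
    rw [hw]
    exact mem_bouquetShift_iff.1 h1 _ _
  · change shiftMap^[n] (shiftMap x) = shiftMap x
    rw [Function.Commute.iterate_self shiftMap n x, show shiftMap^[n] x = x from h2]

/-- A bi-infinite path does not stay inside of a circle. -/
theorem exists_src_eq_base {x : ℤ → BouquetEdge Γ J Q}
    (h : ∀ i, (loopBouquet Γ J Q).tgt (x i) = (loopBouquet Γ J Q).src (x (i + 1))) :
    ∃ i, (loopBouquet Γ J Q).src (x i) = .base := by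
  by_contra! hne
  -- Away from the base the position on the circle grows with each step, which is impossible once `m
  -- = Q`.
  have hform : ∀ m : ℕ, ∃ (j : Fin J) (q : Fin Q), x m = Sum.inl (j, q) ∧ m ≤ q := by
    intro m
    induction m with
    | zero =>
      rcases hx : x (0 : ℕ) with ⟨j, q⟩ | e
      · exact ⟨j, q, rfl, Nat.zero_le _⟩
      · exact absurd (by rw [hx]; rfl) (hne (0 : ℕ))
    | succ m ih =>
      obtain ⟨j, q, hx, hm⟩ := ih
      have h1 := h m
      have h2 := hne (m + 1)
      rw [hx] at h1
      rw [← h1] at h2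
      change bouquetPoint j (q + 1) ≠ _ at h2
      change bouquetPoint j (q + 1) = _ at h1
      have hq : 1 ≤ (q : ℕ) + 1 ∧ (q : ℕ) + 1 < Q := by
        by_contra hq
        exact h2 (dif_neg hq)
      rw [bouquetPoint_of_lt j hq] at h1
      rcases hx' : x (m + 1) with ⟨j', q'⟩ | e
      · rw [hx'] at h1
        change _ = bouquetPoint j' q' at h1
        rw [bouquetPoint] at h1
        split_ifs at h1 with hq'
        refine ⟨j', q', by exact_mod_cast hx', ?_⟩
        injection h1 with _ h1
        omega
      · rw [hx'] at h1
        cases h1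
  obtain ⟨j, q, -, hq⟩ := hform Q
  exact absurd q.2 (by omega)

instance finite_dyckLoop_one [Finite Γ] :
    Finite (DyckLoop (fun _ : Γ => 1) (fun _ : Γ => 1)) := by
  refine Finite.of_surjective (α := Γ × Bool)
    (fun p => if p.2 then DyckLoop.neg p.1 0 else DyckLoop.pos p.1 0) ?_
  rintro (⟨γ, k⟩ | ⟨γ, k⟩)
  · exact ⟨(γ, true), by simp [Subsingleton.elim k 0]⟩
  · exact ⟨(γ, false), by simp [Subsingleton.elim k 0]⟩

theorem injOn_restrict_periodicPoints {n : ℕ} (hn : 0 < n) :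
    Set.InjOn (fun (x : ℤ → BouquetEdge Γ J Q) (k : Fin n) => x (k : ℕ))
      (periodicPoints (bouquetShift Γ J Q) n) := by
  intro x hx y hy hxy
  refine eq_of_wordOf_eq hn ((mem_periodicPoints_bouquetShift_iff hn).1 hx).1
    ((mem_periodicPoints_bouquetShift_iff hn).1 hy).1 ?_
  rw [wordOf, wordOf]
  congr 1
  funext k
  simpa using congrFun hxy k

theorem finite_periodicPoints [Finite Γ] {n : ℕ} (hn : 0 < n) :
    (periodicPoints (bouquetShift Γ J Q) n).Finite :=
  Set.Finite.of_injOn (fun _ _ => Set.mem_univ _) (injOn_restrict_periodicPoints hn)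
    Set.finite_univ

theorem ncard_periodicPoints_le [Finite Γ] {n : ℕ} (hn : 0 < n) :
    (periodicPoints (bouquetShift Γ J Q) n).ncard ≤ Nat.card (BouquetEdge Γ J Q) ^ n := by
  have h := Set.ncard_le_ncard_of_injOn _ (fun _ _ => Set.mem_univ _)
    (injOn_restrict_periodicPoints (Γ := Γ) (J := J) (Q := Q) hn) Set.finite_univ
  rwa [Set.ncard_univ, Nat.card_fun, Nat.card_fin] at h

/-- The points of period `n` are counted by the cyclic words of letters. -/
theorem ncard_periodicPoints_eq [Finite Γ] (hQ : 1 ≤ Q) {n : ℕ} (hn : 0 < n) :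
    ((periodicPoints (bouquetShift Γ J Q) n).ncard : ℚ) =
      n * ∑ k ∈ Finset.range (n + 1),
        (1 / k : ℚ) * ((cyclicBlockWords Γ (Fin J) Q n k).ncard : ℚ) := by
  classical
  have hfin := finite_periodicPoints (Γ := Γ) (J := J) (Q := Q) hn
  have hW : ∀ x, x ∈ hfin.toFinset ↔ x ∈ periodicPoints (bouquetShift Γ J Q) n :=
    fun x => hfin.mem_toFinset
  have hiff := fun x => (hW x).trans (mem_periodicPoints_bouquetShift_iff hn)
  rw [Set.ncard_eq_toFinset_card _ hfin,
    card_eq_mul_sum_inv_countP (fun e => (loopBouquet Γ J Q).src e = .base) hfin.toFinset hn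
      (fun x hx => ((hiff x).1 hx).1)
      (fun x hx => (hW _).2 (shiftMap_mem_periodicPoints ((hW x).1 hx)))
      (fun x hx => exists_src_eq_base ((hiff x).1 hx).2.1)]
  congr 1
  have hB := fun k => finite_cyclicBlockWords (Γ := Γ) (ι := Fin J) Q n k
  -- The sum over `k` becomes one sum over words of total length `n`. No word is lost by `k ≤ n`,
  -- since every letter has length at least 1.
  have hsum : ∑ k ∈ Finset.range (n + 1),
      (1 / k : ℚ) * ((cyclicBlockWords Γ (Fin J) Q n k).ncard : ℚ) =
      ∑ b ∈ (Finset.range (n + 1)).biUnion fun k => (hB k).toFinset, (b.length : ℚ)⁻¹ := by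
    rw [Finset.sum_biUnion]
    · refine Finset.sum_congr rfl fun k _ => ?_
      rw [Finset.sum_congr rfl (g := fun _ => (k : ℚ)⁻¹), Finset.sum_const,
        Set.ncard_eq_toFinset_card _ (hB k), nsmul_eq_mul, one_div, mul_comm]
      intro b hb
      rw [((hB k).mem_toFinset.1 hb).1]
    · intro k _ l _ hkl
      refine Finset.disjoint_left.2 fun b hb hb' => hkl ?_
      rw [← ((hB k).mem_toFinset.1 hb).1, ← ((hB l).mem_toFinset.1 hb').1]
  have hmem : ∀ b : List ((Γ × Bool) ⊕ Fin J),
      b ∈ (Finset.range (n + 1)).biUnion (fun k => (hB k).toFinset) ↔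
      (b.map (blockLength Q)).sum = n ∧ IsNonnilpotent (b.map blockValue).prod := by
    intro b
    simp only [Finset.mem_biUnion, Set.Finite.mem_toFinset, Finset.mem_range]
    constructor
    · rintro ⟨k, -, -, h⟩
      exact h
    · intro h
      refine ⟨b.length, ?_, rfl, h⟩
      rw [Nat.lt_succ_iff, ← h.1, ← List.length_map (blockLength Q)]
      apply List.length_le_sum_of_one_le
      intro m hm
      obtain ⟨c, -, rfl⟩ := List.mem_map.1 hm
      rcases c with c | c
      · exact le_rfl
      · exact hQ
  rw [hsum]
  symm
  have hlen : ∀ b, b ∈ (Finset.range (n + 1)).biUnion (fun k => (hB k).toFinset) →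
      (b.flatMap blockEdges : List (BouquetEdge Γ J Q)).length = n := fun b hb => by
    rw [length_flatMap_blockEdges, ((hmem b).1 hb).1]
  have hword : ∀ (w : List (BouquetEdge Γ J Q)) (hw : 0 < w.length), w.length = n →
      wordOf (periodicExtension w hw) 0 n = w := by
    rintro w hw rfl
    exact wordOf_periodicExtension w hw
  -- A word of letters corresponds to the periodic path that repeats its edges, with a letter
  -- starting at the origin. The weights agree because the number of letters is the number of visits
  -- to the base.
  refine Finset.sum_bij
    (fun b hb => periodicExtension (b.flatMap blockEdges) (by rw [hlen b hb]; exact hn)) ?_ ?_ ?_ ?_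
  · intro b hb
    have hl := hlen b hb
    have hwalk := isWalk_flatMap_blockEdges (Q := Q) b
    have hpos : 0 < (b.flatMap blockEdges : List (BouquetEdge Γ J Q)).length := by omega
    rw [Finset.mem_filter, hiff]
    refine ⟨⟨fun i => ?_, hwalk.tgt_periodicExtension _ hpos, ?_⟩, ?_⟩
    · have := periodicExtension_add _ hpos i
      rwa [hl] at this
    · rw [hword _ _ hl, prod_map_edgeValue_flatMap]
      exact ((hmem b).1 hb).2
    · have := hwalk.src_getElem_zero _ hpos
      simpa [periodicExtension] using this
  · intro b hb b' hb' h
    have h' := congrArg (fun x => wordOf x 0 n) h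
    simp only [hword _ _ (hlen b hb), hword _ _ (hlen b' hb')] at h'
    exact flatMap_blockEdges_injective hQ h'
  · intro y hy
    rw [Finset.mem_filter, hiff] at hy
    obtain ⟨⟨hper, hpath, hval⟩, hbase⟩ := hy
    have hwalk := (loopBouquet Γ J Q).isWalk_wordOf hpath 0 n
    rw [hper, hbase] at hwalk
    obtain ⟨b, hb⟩ := exists_flatMap_blockEdges_eq hwalk
    have hb' : b ∈ (Finset.range (n + 1)).biUnion (fun k => (hB k).toFinset) := by
      rw [hmem, ← length_flatMap_blockEdges (Γ := Γ), ← prod_map_edgeValue_flatMap (Q := Q), hb,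
        length_wordOf]
      exact ⟨rfl, hval⟩
    refine ⟨b, hb', ?_⟩
    have hl := hlen b hb'
    have hpos : 0 < (b.flatMap blockEdges : List (BouquetEdge Γ J Q)).length := by omega
    refine eq_of_wordOf_eq hn (fun i => ?_) hper ?_
    · have := periodicExtension_add _ hpos i
      rwa [hl] at this
    · rw [hword _ _ hl, hb]
  · intro b hb
    rw [hword _ _ (hlen b hb), countP_flatMap_blockEdges hQ]

/-- The factors `1/k` from the count of marked positions are the coefficients of the logarithm. For
`n = 0` only `k = 0` is left, with coefficient 0. -/
theorem zetaCoeff_bouquetShift [Fintype Γ] (hQ : 1 ≤ Q) (n : ℕ) :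
    zetaCoeff (bouquetShift Γ J Q) n = laurentMaxEval (Fintype.card Γ) (PowerSeries.coeff n
      ((negLogOneSub (LaurentPolynomial ℚ)).subst
        (PowerSeries.C (LaurentPolynomial.T 1) * PowerSeries.X +
          PowerSeries.C (LaurentPolynomial.C (Fintype.card Γ : ℚ) * LaurentPolynomial.T (-1)) *
            PowerSeries.X +
          PowerSeries.C (LaurentPolynomial.C (J : ℚ)) * PowerSeries.X ^ Q))) := by
  have hQ0 : Q ≠ 0 := by omega
  rw [coeff_negLogOneSub_subst (by simp [hQ0]), map_sum]
  simp only [laurentMaxEval_smul]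
  have h := fun k => ncard_cyclicBlockWords (Γ := Γ) (ι := Fin J) Q n k
  simp only [Fintype.card_fin] at h
  simp only [← h]
  rw [zetaCoeff]
  split_ifs with hn
  · subst hn
    simp
  · rw [ncard_periodicPoints_eq hQ (Nat.pos_of_ne_zero hn), mul_div_cancel_left₀]
    exact_mod_cast hn

end BouquetZeta

/-- The zeta function of the subshift of the bouquet of `J` circles of length `Q` with Dyck loops,
as an identity of formal power series (the square root being the one with constant term `1`),
and as an identity of functions of a complex variable near `0` (with the principal root). -/
theorem corollary2p5 {Γ : Type*} [Fintype Γ] (N J Q : ℕ) (hΓ : Fintype.card Γ = N) (hN : 1 < N)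
    (hJ : 1 ≤ J) (hQ : 1 ≤ Q) :
    (∃ S : ℚ⟦X⟧, PowerSeries.constantCoeff S = 1 ∧
      S ^ 2 = (1 - (J : ℚ⟦X⟧) * PowerSeries.X ^ Q) ^ 2 - 4 * (N : ℚ⟦X⟧) * PowerSeries.X ^ 2 ∧
      zetaSeries (bouquetShift Γ J Q) =
        2 * (1 - (J : ℚ⟦X⟧) * PowerSeries.X ^ Q + S) *
          ((1 - (J : ℚ⟦X⟧) * PowerSeries.X ^ Q - 2 * (N : ℚ⟦X⟧) * PowerSeries.X + S) ^ 2)⁻¹) ∧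
    (∀ᶠ z : ℂ in nhds 0,
      Summable (fun n : ℕ => (zetaCoeff (bouquetShift Γ J Q) n : ℂ) * z ^ n) ∧
      1 - J * z ^ Q - 2 * N * z + Complex.sqrt ((1 - J * z ^ Q) ^ 2 - 4 * N * z ^ 2) ≠ 0 ∧
      Complex.exp (∑' n : ℕ, (zetaCoeff (bouquetShift Γ J Q) n : ℂ) * z ^ n) =
        2 * (1 - J * z ^ Q + Complex.sqrt ((1 - J * z ^ Q) ^ 2 - 4 * N * z ^ 2)) /
          (1 - J * z ^ Q - 2 * N * z +
            Complex.sqrt ((1 - J * z ^ Q) ^ 2 - 4 * N * z ^ 2)) ^ 2) := by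
  have hQ0 : Q ≠ 0 := by omega
  obtain ⟨D, hD, hDeq⟩ := exists_dyckSeries N J hQ
  have hL : PowerSeries.mk (zetaCoeff (bouquetShift Γ J Q)) + (negLogOneSub ℚ).subst (1 - D) =
      2 * (negLogOneSub ℚ).subst (PowerSeries.C (N : ℚ) * PowerSeries.X * D) := by
    rw [← laurentMaxEval_coeff_negLogOneSub N J hQ hD hDeq, ← hΓ]
    congr 2
    funext n
    exact zetaCoeff_bouquetShift hQ n
  obtain ⟨S, hS0, hS, hE⟩ := exists_sqrt_closedForm N J hQ hD hDeq hL
  simp only [map_natCast] at hS hE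
  refine ⟨⟨S, hS0, hS, ?_⟩, ?_⟩
  · rw [PowerSeries.eq_mul_inv_iff_mul_eq]
    · exact hE
    · simp [hS0, hQ0]
  · have : Nonempty Γ := Fintype.card_pos_iff.1 (by omega)
    have hB : 0 < Nat.card (BouquetEdge Γ J Q) := by
      have : Nonempty (BouquetEdge Γ J Q) := ⟨Sum.inr (DyckLoop.neg (Classical.arbitrary Γ) 0)⟩
      exact Nat.card_pos
    -- A periodic point is determined by its period word, so the number of edges serves as the
    -- growth rate `B`.
    refine closedForm_of_formal N J hQ (by simp [zetaCoeff])
      (B := (Nat.card (BouquetEdge Γ J Q) : ℝ)) (by exact_mod_cast hB) (fun n => ?_) hS0 hS hE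
    rw [zetaCoeff]
    split_ifs with hn
    · rw [Rat.cast_zero, abs_zero]
      positivity
    · have h1 : (1 : ℝ) ≤ n := by exact_mod_cast Nat.one_le_iff_ne_zero.2 hn
      have h2 := ncard_periodicPoints_le (Γ := Γ) (J := J) (Q := Q) (Nat.pos_of_ne_zero hn)
      push_cast
      rw [abs_of_nonneg (by positivity)]
      calc _ ≤ ((periodicPoints (bouquetShift Γ J Q) n).ncard : ℝ) :=
            div_le_self (by positivity) h1
        _ ≤ _ := by exact_mod_cast h2
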